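/- Theorem. Let $d\ge 0$, with $\mathbb N=\{0,1,2,\dots\}$ and $e_0,\dots,e_d$ the canonical basis of $\mathbb N^{d+1}$. Consider variables $z_k$ ($k\in\mathbb N$) and $z_n$ ($n\in\mathbb N^{d+1}\setminus\{0\}$), and for a multi-index $\gamma$ over them (finitely supported) put $[\gamma]=\sum_{k} k\,\gamma(k)-\sum_{n\ne 0}\gamma(n)$. Consider the derivations $$D^{(0)}=\sum_{k}(k+1)z_{k+1}\partial_{z_k},\qquad D^{(n)}=\partial_{z_n}\ (n\neq 0),\qquad \partial_i=\sum_{n\in\mathbb N^{d+1}}(n_i+1)z_{n+e_i}D^{(n)}\ (0\le i\le d).$$ Let $\tilde L$ be the real span of the $z^\gamma D^{(n)}$ with $[\gamma]\ge 0$ and $n\in\mathbb N^{d+1}$ (which are linearly independent together with the $\partial_i$), and $L=\tilde L\oplus\langle\partial_0,\dots,\partial_d\rangle_{\mathbb R}$ with the commutator bracket, that is, $[\partial_i,\partial_j]=0$ and $$[z^\gamma D^{(n)},z^{\gamma'}D^{(n')}]=z^\gamma (D^{(n)}z^{\gamma'})D^{(n')}-z^{\gamma'}(D^{(n')}z^{\gamma})D^{(n)},\qquad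 [z^\gamma D^{(n)},\partial_i]=n_i z^\gamma D^{(n-e_i)}-(\partial_i z^\gamma)D^{(n)}.$$ Let $L_0$ be the vector space $L$ with the Lie bracket $[\cdot,\cdot]_0$ that vanishes on $\tilde L\times\tilde L$ and on pairs of $\partial$'s and satisfies $[z^\gamma D^{(n)},\partial_i]_0=n_i z^\gamma D^{(n-e_i)}$. Define a bilinear product $\triangleright$ on $L_0$ by $$z^\gamma D^{(n)}\triangleright z^{\gamma'}D^{(n')}=z^\gamma(D^{(n)}z^{\gamma'})D^{(n')},\qquad \partial_i\triangleright z^\gamma D^{(n)}=(\partial_i z^\gamma)D^{(n)},\qquad x\triangleright\partial_i=0 .$$ For a Lie algebra $\mathfrak g$, let $U(\mathfrak g)$ be its enveloping algebra with its standard Hopf algebra structure, $\Delta x=x\otimes 1+1\otimes x$ for $x\in\mathfrak g$. Then the following hold. 1. The product $\triangleright$ extends in exactly one way to a bilinear product on $U(L_0)$ such that, for $x,y\in L_0$ and $A,B,C\in U(L_0)$, in Sweedler notation, $$\mathbf 1\triangleright A=A,\quad x\triangleright\mathbf 1=0,\quad xA\triangleright y=x\triangleright(A\triangleright y)-(x\triangleright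 A)\triangleright y,\quad A\triangleright BC=\sum (A^{(1)}\triangleright B)(A^{(2)}\triangleright C).$$ With $A\star B=\sum A^{(1)}(A^{(2)}\triangleright B)$, the triple $(U(L_0),\star,\Delta)$, with the unit and counit of $U(L_0)$, is a Hopf algebra. 2. There is an isomorphism of Hopf algebras $\Phi:U(L)\to(U(L_0),\star,\Delta)$ with $\Phi(x)=x$ for all $x\in L$. 3. $U(L)$ has a basis $B_{(J,m)}$, indexed by the finite multisets $J$ of pairs $(\gamma,n)$ with $[\gamma]\ge0$, $n\in\mathbb N^{d+1}$, and by $m\in\mathbb N^{d+1}$, that is symmetric in the elements $z^\gamma D^{(n)}$ of $\tilde L$: for every enumeration $(\gamma_1,n_1),\dots,(\gamma_r,n_r)$ of $J$, $$\Phi(B_{(J,m)})=\partial_0^{m_0}\cdots\partial_d^{m_d}\;z^{\gamma_1}D^{(n_1)}\cdots z^{\gamma_r}D^{(n_r)},$$ where the right-hand side is a product in $U(L_0)$ for its usual (concatenation) multiplication. 4. This is the partially symmetric (normally ordered) basis, without normalising factors $1/(J!\,m!)$, described inside $U(L)$ as follows: $B_{(\emptyset,m)}=\partial_0^{m_0}\cdots\partial_d^{m_d}$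 in $U(L)$, and there is a linear family of maps $W_x:U(L)\to U(L)$, $x\in L$, with $W_x(1)=x$ and $W_x(yA)=y\,W_x(A)-W_{y\triangleright x}(A)$ for $y\in L$, $A\in U(L)$, such that $B_{(J+\{(\gamma,n)\},m)}=W_{z^\gamma D^{(n)}}(B_{(J,m)})$ for all $J$, $m$ and $(\gamma,n)$. -/

import Mathlib

open scoped TensorProduct

noncomputable section

/-! ## The Hopf algebra structure of an enveloping algebra -/

namespace UEA

attribute [local instance 100] LieRing.ofAssociativeRing

variable (R : Type*) [CommRing R] (g : Type*) [LieRing g] [LieAlgebra R g]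

local notation "U" => UniversalEnvelopingAlgebra R g
local notation "inc" => UniversalEnvelopingAlgebra.ι R (L := g)

/-- The coproduct `Δ : U(g) → U(g) ⊗ U(g)`: the algebra morphism with `Δ x = x ⊗ 1 + 1 ⊗ x`
for `x ∈ g`. -/
def comulHom : U →ₐ[R] U ⊗[R] U :=
  UniversalEnvelopingAlgebra.lift R
    { toFun := fun x => inc x ⊗ₜ[R] (1 : U) + (1 : U) ⊗ₜ[R] inc x
      map_add' := fun x y => by
        simp only [map_add, TensorProduct.add_tmul, TensorProduct.tmul_add]; abel
      map_smul' := fun r x => by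
        simp only [map_smul, TensorProduct.smul_tmul', TensorProduct.tmul_smul, smul_add,
          RingHom.id_apply]
      map_lie' := fun {x y} => by
        simp only [LieHom.map_lie, LieRing.of_associative_ring_bracket, mul_add, add_mul,
          Algebra.TensorProduct.tmul_mul_tmul, one_mul, mul_one, TensorProduct.sub_tmul,
          TensorProduct.tmul_sub]
        abel }

/-- The counit `ε : U(g) → R`: the algebra morphism that vanishes on `g`. -/
def counitHom : U →ₐ[R] R := UniversalEnvelopingAlgebra.lift R (0 : g →ₗ⁅R⁆ R)

/-- The antipode, as an algebra morphism `U(g) → U(g)ᵒᵖ` with `x ↦ -x` for `x ∈ g`. -/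
def antipodeHom : U →ₐ[R] (U)ᵐᵒᵖ :=
  UniversalEnvelopingAlgebra.lift R
    { toFun := fun x => MulOpposite.op (-(inc x))
      map_add' := fun x y => by
        rw [← MulOpposite.op_add, map_add, neg_add]
      map_smul' := fun r x => by
        simp only [map_smul, RingHom.id_apply, ← MulOpposite.op_smul, smul_neg]
      map_lie' := fun {x y} => by
        simp only [LieHom.map_lie, LieRing.of_associative_ring_bracket, ← MulOpposite.op_mul,
          ← MulOpposite.op_sub]
        congr 1
        noncomm_ring }

/-- The antipode of `U(g)`: the linear anti-automorphism with `x ↦ -x` for `x ∈ g`. -/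
def antipodeLin : U →ₗ[R] U :=
  (MulOpposite.opLinearEquiv R).symm.toLinearMap ∘ₗ (antipodeHom R g).toLinearMap

variable {g}

@[simp] theorem comulHom_inc (x : g) :
    comulHom R g (inc x) = inc x ⊗ₜ[R] 1 + 1 ⊗ₜ[R] inc x := by
  rw [comulHom, UniversalEnvelopingAlgebra.lift_ι_apply]; rfl

@[simp] theorem counitHom_inc (x : g) : counitHom R g (inc x) = 0 := by
  rw [counitHom, UniversalEnvelopingAlgebra.lift_ι_apply]; rfl

@[simp] theorem antipodeLin_inc (x : g) : antipodeLin R g (inc x) = -inc x := by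
  simp only [antipodeLin, antipodeHom, LinearMap.comp_apply, AlgHom.toLinearMap_apply,
    UniversalEnvelopingAlgebra.lift_ι_apply]; rfl

@[simp] theorem antipodeLin_mul (a b : U) :
    antipodeLin R g (a * b) = antipodeLin R g b * antipodeLin R g a := by
  simp [antipodeLin]

@[simp] theorem antipodeLin_one : antipodeLin R g (1 : U) = 1 := by
  simp [antipodeLin]

variable (g)

theorem adjoin_range : Algebra.adjoin R (Set.range inc) = ⊤ := by
  set S := Algebra.adjoin R (Set.range inc)
  let f : g →ₗ⁅R⁆ S :=
    { toFun := fun x => ⟨inc x, Algebra.subset_adjoin ⟨x, rfl⟩⟩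
      map_add' := fun x y => Subtype.ext (map_add _ x y)
      map_smul' := fun r x => Subtype.ext (map_smul _ r x)
      map_lie' := fun {x y} => Subtype.ext (LieHom.map_lie _ x y) }
  have h : S.val.comp (UniversalEnvelopingAlgebra.lift R f) = AlgHom.id R U := by
    apply UniversalEnvelopingAlgebra.hom_ext
    ext x
    change (UniversalEnvelopingAlgebra.lift R f (inc x) : U) = inc x
    rw [UniversalEnvelopingAlgebra.lift_ι_apply]
    rfl
  rw [eq_top_iff]
  intro a _
  have := congrArg (fun F : U →ₐ[R] U => F a) h
  change ((UniversalEnvelopingAlgebra.lift R f a : S) : U) = a at this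
  rw [← this]
  exact Subtype.property _

theorem algHom_ext {A : Type*} [Ring A] [Algebra R A] {F G : U →ₐ[R] A}
    (h : ∀ x : g, F (inc x) = G (inc x)) : F = G :=
  UniversalEnvelopingAlgebra.hom_ext R (LieHom.ext h)

instance : Bialgebra R U :=
  Bialgebra.ofAlgHom (comulHom R g) (counitHom R g)
    (by
      refine algHom_ext R g fun x => ?_
      change (Algebra.TensorProduct.assoc R R R U U U)
        (Algebra.TensorProduct.map (comulHom R g) (.id R U) (comulHom R g (inc x)))
        = Algebra.TensorProduct.map (.id R U) (comulHom R g) (comulHom R g (inc x))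
      simp [TensorProduct.add_tmul, TensorProduct.tmul_add, Algebra.TensorProduct.one_def,
        add_assoc, -UniversalEnvelopingAlgebra.ι_apply])
    (by
      refine algHom_ext R g fun x => ?_
      change Algebra.TensorProduct.map (counitHom R g) (.id R U) (comulHom R g (inc x))
        = (Algebra.TensorProduct.lid R U).symm (inc x)
      simp [-UniversalEnvelopingAlgebra.ι_apply])
    (by
      refine algHom_ext R g fun x => ?_
      change Algebra.TensorProduct.map (.id R U) (counitHom R g) (comulHom R g (inc x))
        = (Algebra.TensorProduct.rid R R U).symm (inc x)
      simp [-UniversalEnvelopingAlgebra.ι_apply])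

theorem antipode_left_aux (a : U) : ∀ t : U ⊗[R] U,
    LinearMap.mul' R U ((antipodeLin R g).rTensor U (comulHom R g a * t))
      = counitHom R g a • LinearMap.mul' R U ((antipodeLin R g).rTensor U t) := by
  have ha : a ∈ Algebra.adjoin R (Set.range inc) := by rw [adjoin_range]; trivial
  induction ha using Algebra.adjoin_induction with
  | mem y hy =>
    obtain ⟨x, rfl⟩ := hy
    intro t
    rw [comulHom_inc, counitHom_inc, zero_smul]
    induction t with
    | zero => simp
    | add s t hs ht => rw [mul_add, map_add, map_add, hs, ht, add_zero]
    | tmul b c => simp [add_mul, mul_assoc, -UniversalEnvelopingAlgebra.ι_apply]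
  | algebraMap r =>
    intro t
    rw [AlgHom.commutes, AlgHom.commutes, ← Algebra.smul_def, map_smul, map_smul]
    rfl
  | add a b _ _ ha hb => intro t; simp only [map_add, add_mul, add_smul, ha, hb]
  | mul a b _ _ ha hb => intro t; rw [map_mul (comulHom R g), map_mul (counitHom R g), mul_assoc, ha, hb, mul_smul]

theorem antipode_right_aux (a : U) : ∀ t : U ⊗[R] U,
    LinearMap.mul' R U ((antipodeLin R g).lTensor U (t * comulHom R g a))
      = counitHom R g a • LinearMap.mul' R U ((antipodeLin R g).lTensor U t) := by
  have ha : a ∈ Algebra.adjoin R (Set.range inc) := by rw [adjoin_range]; trivial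
  induction ha using Algebra.adjoin_induction with
  | mem y hy =>
    obtain ⟨x, rfl⟩ := hy
    intro t
    rw [comulHom_inc, counitHom_inc, zero_smul]
    induction t with
    | zero => simp
    | add s t hs ht => rw [add_mul, map_add, map_add, hs, ht, add_zero]
    | tmul b c => simp [mul_add, mul_assoc, -UniversalEnvelopingAlgebra.ι_apply]
  | algebraMap r =>
    intro t
    rw [AlgHom.commutes, AlgHom.commutes, ← Algebra.commutes, ← Algebra.smul_def, map_smul,
      map_smul]
    rfl
  | add a b _ _ ha hb => intro t; simp only [map_add, mul_add, add_smul, ha, hb]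
  | mul a b _ _ ha hb =>
    intro t; rw [map_mul (comulHom R g), map_mul (counitHom R g), ← mul_assoc, hb, ha, smul_smul, mul_comm]

theorem antipode_left (a : U) :
    LinearMap.mul' R U ((antipodeLin R g).rTensor U (comulHom R g a))
      = algebraMap R U (counitHom R g a) := by
  have h := antipode_left_aux R g a 1
  rw [mul_one] at h
  rw [h, Algebra.algebraMap_eq_smul_one, Algebra.TensorProduct.one_def]
  simp

theorem antipode_right (a : U) :
    LinearMap.mul' R U ((antipodeLin R g).lTensor U (comulHom R g a))
      = algebraMap R U (counitHom R g a) := by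
  have h := antipode_right_aux R g a 1
  rw [one_mul] at h
  rw [h, Algebra.algebraMap_eq_smul_one, Algebra.TensorProduct.one_def]
  simp

/-- The standard Hopf algebra structure of the enveloping algebra of a Lie algebra. -/
instance : HopfAlgebra R U where
  antipode := antipodeLin R g
  mul_antipode_rTensor_comul := by
    ext a; exact antipode_left R g a
  mul_antipode_lTensor_comul := by
    ext a; exact antipode_right R g a

end UEA

/-! ## The product `⋆` on the enveloping algebra of a post-Lie algebra -/

namespace PostLie

open UniversalEnvelopingAlgebra

variable {g : Type*} [LieRing g] [LieAlgebra ℝ g]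

local notation "U" => UniversalEnvelopingAlgebra ℝ g

/-- `T A B = A ▷ B` is an extension to `U(g)` of the bilinear product `tri x y = x ▷ y` on the Lie
algebra `g`: it satisfies `1 ▷ A = A`, `x ▷ 1 = 0`, `(x A) ▷ y = x ▷ (A ▷ y) - (x ▷ A) ▷ y` and
`A ▷ (B C) = ∑ (A⁽¹⁾ ▷ B) (A⁽²⁾ ▷ C)` for `x, y ∈ g` and `A, B, C ∈ U(g)`. -/
structure IsExtension (tri : g →ₗ[ℝ] g →ₗ[ℝ] g) (T : U →ₗ[ℝ] U →ₗ[ℝ] U) : Prop where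
  extend : ∀ x y : g, T (ι ℝ x) (ι ℝ y) = ι ℝ (tri x y)
  gen_one : ∀ x : g, T (ι ℝ x) 1 = 0
  one_left : ∀ A : U, T 1 A = A
  gen_mul_left : ∀ (x : g) (A : U) (y : g),
    T (ι ℝ x * A) (ι ℝ y) = T (ι ℝ x) (T A (ι ℝ y)) - T (T (ι ℝ x) A) (ι ℝ y)
  mul_right : ∀ A B C : U,
    T A (B * C) =
      LinearMap.mul' ℝ U (TensorProduct.map (T.flip B) (T.flip C) (Coalgebra.comul (R := ℝ) A))

/-- The product `A ⋆ B = ∑ A⁽¹⁾ (A⁽²⁾ ▷ B)` on `U(g)`, where `A ▷ B = T A B`. -/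
def star (T : U →ₗ[ℝ] U →ₗ[ℝ] U) : U →ₗ[ℝ] U →ₗ[ℝ] U :=
  LinearMap.mk₂ ℝ
    (fun A B => LinearMap.mul' ℝ U
      (TensorProduct.map LinearMap.id (T.flip B) (Coalgebra.comul (R := ℝ) A)))
    (fun A A' B => by simp only [map_add])
    (fun c A B => by simp only [map_smul])
    (fun A B B' => by
      simp only [map_add, TensorProduct.map_add_right, LinearMap.add_apply])
    (fun c A B => by
      simp only [map_smul, TensorProduct.map_smul_right, LinearMap.smul_apply])

end PostLie

/-- The coalgebra `H`, with the multiplication `mul`, the unit `one` and the antipode `S`, is a Hopf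
algebra. -/
structure IsHopfAlgebraWith {H : Type*} [AddCommGroup H] [Module ℝ H] [Coalgebra ℝ H]
    (mul : H →ₗ[ℝ] H →ₗ[ℝ] H) (one : H) (S : H →ₗ[ℝ] H) : Prop where
  mul_assoc : ∀ a b c : H, mul (mul a b) c = mul a (mul b c)
  one_mul : ∀ a : H, mul one a = a
  mul_one : ∀ a : H, mul a one = a
  comul_mul : ∀ a b : H, Coalgebra.comul (R := ℝ) (mul a b) =
    TensorProduct.map₂ mul mul (Coalgebra.comul (R := ℝ) a) (Coalgebra.comul (R := ℝ) b)
  comul_one : Coalgebra.comul (R := ℝ) one = one ⊗ₜ[ℝ] one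
  counit_mul : ∀ a b : H, Coalgebra.counit (R := ℝ) (mul a b) =
    Coalgebra.counit (R := ℝ) a * Coalgebra.counit (R := ℝ) b
  counit_one : Coalgebra.counit (R := ℝ) one = (1 : ℝ)
  antipode_left : ∀ a : H,
    TensorProduct.lift mul (TensorProduct.map S LinearMap.id (Coalgebra.comul (R := ℝ) a)) =
      Coalgebra.counit (R := ℝ) a • one
  antipode_right : ∀ a : H,
    TensorProduct.lift mul (TensorProduct.map LinearMap.id S (Coalgebra.comul (R := ℝ) a)) =
      Coalgebra.counit (R := ℝ) a • one

/-! ## Multi-indices and the Lie algebras `L` and `L₀` -/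

namespace MultiIndices

open MvPolynomial

variable (d : ℕ)

/-- Elements `n` of `ℕ^{d+1}`. -/
abbrev NN := Fin (d + 1) → ℕ

/-- The canonical basis of `ℕ^{d+1}`. -/
abbrev unitVec {d : ℕ} (i : Fin (d + 1)) : NN d := Pi.single i 1

/-- The variables: `z_k` for `k ∈ ℕ` and `z_n` for `n ∈ ℕ^{d+1}`, `n ≠ 0`. -/
abbrev Var := ℕ ⊕ {n : NN d // n ≠ 0}

/-- Multi-indices over the variables. -/
abbrev MIdx := Var d →₀ ℕ

/-- Polynomials in the variables; `monomial γ 1` is `z^γ`. -/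
abbrev Poly := MvPolynomial (Var d) ℝ

variable {d}

theorem add_unitVec_ne_zero (n : NN d) (i : Fin (d + 1)) : n + unitVec i ≠ 0 := fun h => by
  simpa using congrFun h i

/-- The variable `z_{n + e_i}`. -/
abbrev shiftVar (n : NN d) (i : Fin (d + 1)) : Var d := Sum.inr ⟨n + unitVec i, add_unitVec_ne_zero n i⟩

/-- The weight of the variable: `k` for `z_k` and `-1` for `z_n`. -/
def varWt : Var d → ℤ := Sum.elim (fun k => (k : ℤ)) (fun _ => -1)

/-- `[γ] = ∑_k k γ(k) - ∑_{n ≠ 0} γ(n)`. -/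
def wt (γ : MIdx d) : ℤ := Finsupp.weight varWt γ

/-- The derivations `D^{(0)} = ∑_k (k+1) z_{k+1} ∂_{z_k}` and `D^{(n)} = ∂_{z_n}`, `n ≠ 0`. -/
def D (n : NN d) : Derivation ℝ (Poly d) (Poly d) :=
  if h : n = 0 then
    mkDerivation ℝ (Sum.elim (fun k => ((k : ℝ) + 1) • X (Sum.inl (k + 1))) (fun _ => 0))
  else pderiv (Sum.inr ⟨n, h⟩)

/-- The derivations `∂_i = ∑_n (n_i + 1) z_{n + e_i} D^{(n)}`, where `n` ranges over `ℕ^{d+1}`;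
on each variable at most one term of the sum does not vanish. -/
def del (i : Fin (d + 1)) : Derivation ℝ (Poly d) (Poly d) :=
  mkDerivation ℝ (Sum.elim
    (fun k => X (shiftVar 0 i) * (((k : ℝ) + 1) • X (Sum.inl (k + 1))))
    (fun n => ((n.1 i : ℝ) + 1) • X (shiftVar n.1 i)))

variable (d)

/-- Indices `(γ, n)` of the elements `z^γ D^{(n)}` with `[γ] ≥ 0`. -/
abbrev TildeIdx := {γ : MIdx d // 0 ≤ wt γ} × NN d

/-- Indices of the generators `z^γ D^{(n)}`, `[γ] ≥ 0`, and `∂_i`. -/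
abbrev Gen := TildeIdx d ⊕ Fin (d + 1)

/-- The real vector space with the basis `z^γ D^{(n)}`, `[γ] ≥ 0`, and `∂_i`. -/
abbrev Space := Gen d →₀ ℝ

variable {d}

/-- The basis element `z^γ D^{(n)}`. -/
abbrev zD (a : TildeIdx d) : Space d := Finsupp.single (Sum.inl a) 1

/-- The basis element `∂_i`. -/
abbrev dl (i : Fin (d + 1)) : Space d := Finsupp.single (Sum.inr i) 1

/-- The element `p D^{(n)} = ∑_{[β] ≥ 0} p_β z^β D^{(n)}` for a polynomial `p = ∑_β p_β z^β`. -/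
def polyD (n : NN d) : Poly d →ₗ[ℝ] Space d :=
  (basisMonomials (Var d) ℝ).constr ℝ
    (fun β => if h : 0 ≤ wt β then zD (⟨β, h⟩, n) else 0)

/-- The bilinear extension of a product of basis elements. -/
def bilin (f : Gen d → Gen d → Space d) : Space d →ₗ[ℝ] Space d →ₗ[ℝ] Space d :=
  Finsupp.linearCombination ℝ (fun a => Finsupp.linearCombination ℝ (f a))

/-- The bracket `[·,·]` on the basis. The polynomial `z^γ D^{(n)} z^{γ'}` has the coefficients
`(z^γ D^{(n)})^{γ'}_{β'}`, and `∂_i z^γ` has the coefficients `(∂_i)^γ_β`. -/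
def brGen : Gen d → Gen d → Space d
  | Sum.inl (γ, n), Sum.inl (γ', n') =>
      polyD n' (monomial γ.1 1 * D n (monomial γ'.1 1))
        - polyD n (monomial γ'.1 1 * D n' (monomial γ.1 1))
  | Sum.inl (γ, n), Sum.inr i =>
      (n i : ℝ) • zD (γ, n - unitVec i) - polyD n (del i (monomial γ.1 1))
  | Sum.inr i, Sum.inl (γ, n) =>
      -((n i : ℝ) • zD (γ, n - unitVec i) - polyD n (del i (monomial γ.1 1)))
  | Sum.inr _, Sum.inr _ => 0

/-- The bracket `[·,·]₀` on the basis. -/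
def brGen₀ : Gen d → Gen d → Space d
  | Sum.inl _, Sum.inl _ => 0
  | Sum.inl (γ, n), Sum.inr i => (n i : ℝ) • zD (γ, n - unitVec i)
  | Sum.inr i, Sum.inl (γ, n) => -((n i : ℝ) • zD (γ, n - unitVec i))
  | Sum.inr _, Sum.inr _ => 0

/-- The post-Lie product on the basis: `z^γ D^{(n)} ▶ z^{γ'} D^{(n')}` is
`∑_{β'} (z^γ D^{(n)})^{γ'}_{β'} z^{β'} D^{(n')}`, `∂_i ▶ z^γ D^{(n)}` is `(∂_i z^γ) D^{(n)}`, and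
`x ▶ ∂_i = 0`. -/
def triGen : Gen d → Gen d → Space d
  | Sum.inl (γ, n), Sum.inl (γ', n') => polyD n' (monomial γ.1 1 * D n (monomial γ'.1 1))
  | Sum.inr i, Sum.inl (γ, n) => polyD n (del i (monomial γ.1 1))
  | _, Sum.inr _ => 0

/-! ### Realisation by derivations, and the Jacobi identities -/

theorem wt_eq (γ : MIdx d) : wt γ = Finsupp.weight varWt γ := rfl

theorem isHom_mkDerivation (f : Var d → Poly d) (c : ℤ)
    (hf : ∀ v, IsWeightedHomogeneous varWt (f v) (varWt v + c)) (γ : MIdx d) :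
    IsWeightedHomogeneous varWt (mkDerivation ℝ f (monomial γ 1)) (wt γ + c) := by
  rw [mkDerivation_monomial, one_smul]
  refine IsWeightedHomogeneous.sum _ _ _ fun v hv => ?_
  simp only [smul_eq_mul]
  have h1 : IsWeightedHomogeneous (R := ℝ) varWt
      (monomial (γ - Finsupp.single v 1) ((γ v : ℕ) : ℝ)) (wt γ - varWt v) := by
    refine isWeightedHomogeneous_monomial _ _ _ ?_
    have h2 : γ - Finsupp.single v 1 + Finsupp.single v 1 = γ :=
      tsub_add_cancel_of_le (by
        rw [Finsupp.single_le_iff]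
        exact Nat.one_le_iff_ne_zero.2 (Finsupp.mem_support_iff.1 hv))
    have h3 := congrArg (Finsupp.weight varWt) h2
    rw [map_add, Finsupp.weight_single] at h3
    rw [wt_eq, ← h3]; simp
  have h4 := h1.mul (hf v)
  convert h4 using 1
  ring

theorem isHom_D (n : NN d) (γ : MIdx d) :
    IsWeightedHomogeneous varWt (D n (monomial γ 1)) (wt γ + 1) := by
  unfold D
  split_ifs with h
  · refine isHom_mkDerivation _ _ (fun v => ?_) γ
    rcases v with k | m
    · have := (isWeightedHomogeneous_X ℝ (varWt (d := d)) (Sum.inl (k + 1)))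
      simp only [Sum.elim_inl]
      rw [smul_eq_C_mul]
      have h2 := (isWeightedHomogeneous_C (varWt (d := d)) ((k : ℝ) + 1)).mul this
      convert h2 using 1
      simp [varWt]
    · simpa using isWeightedHomogeneous_zero ℝ _ _
  · rw [pderiv_def]
    refine isHom_mkDerivation _ _ (fun v => ?_) γ
    by_cases hv : v = Sum.inr ⟨n, h⟩
    · subst hv
      simpa [varWt] using isWeightedHomogeneous_one ℝ (varWt (d := d))
    · rw [Pi.single_eq_of_ne hv]
      exact isWeightedHomogeneous_zero ℝ _ _

theorem isHom_del (i : Fin (d + 1)) (γ : MIdx d) :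
    IsWeightedHomogeneous varWt (del i (monomial γ 1)) (wt γ) := by
  have := isHom_mkDerivation (d := d) (Sum.elim
    (fun k => X (shiftVar 0 i) * (((k : ℝ) + 1) • X (Sum.inl (k + 1))))
    (fun n => ((n.1 i : ℝ) + 1) • X (shiftVar n.1 i))) 0 (fun v => by
      rcases v with k | m
      · simp only [Sum.elim_inl]
        rw [smul_eq_C_mul]
        have h2 := (isWeightedHomogeneous_X ℝ (varWt (d := d)) (shiftVar 0 i)).mul
          ((isWeightedHomogeneous_C (varWt (d := d)) ((k : ℝ) + 1)).mul
            (isWeightedHomogeneous_X ℝ (varWt (d := d)) (Sum.inl (k + 1))))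
        convert h2 using 1
        simp [varWt]
      · simp only [Sum.elim_inr]
        rw [smul_eq_C_mul]
        have h2 := (isWeightedHomogeneous_C (varWt (d := d)) ((m.1 i : ℝ) + 1)).mul
            (isWeightedHomogeneous_X ℝ (varWt (d := d)) (shiftVar m.1 i))
        convert h2 using 1
        simp [varWt]) γ
  rw [add_zero] at this
  exact this

/-- The derivation that a basis element stands for. -/
def genDer : Gen d → Derivation ℝ (Poly d) (Poly d)
  | Sum.inl (γ, n) => (monomial γ.1 (1 : ℝ) : Poly d) • D n
  | Sum.inr i => del i

/-- The realisation of the elements of `L` as derivations; its range is the span of the derivations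
`z^γ D^{(n)}`, `[γ] ≥ 0`, and `∂_i`. -/
def toDer : Space d →ₗ[ℝ] Derivation ℝ (Poly d) (Poly d) :=
  Finsupp.linearCombination ℝ genDer

@[simp] theorem toDer_single (a : Gen d) (c : ℝ) :
    toDer (Finsupp.single a c) = c • genDer a := by
  simp [toDer]

theorem toDer_polyD (n : NN d) (p : Poly d) (hp : ∀ β, coeff β p ≠ 0 → 0 ≤ wt β) :
    toDer (polyD n p) = p • D n := by
  conv_lhs => rw [p.as_sum]
  conv_rhs => rw [p.as_sum]
  rw [map_sum, map_sum, Finset.sum_smul]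
  refine Finset.sum_congr rfl fun β hβ => ?_
  have hw := hp β (mem_support_iff.1 hβ)
  have : (monomial β (coeff β p) : Poly d) = coeff β p • (basisMonomials (Var d) ℝ) β := by
    simp [smul_monomial]
  rw [this, map_smul, map_smul, polyD, Module.Basis.constr_basis, dif_pos hw, toDer_single,
    one_smul, smul_assoc]
  simp [genDer]

theorem good_mul_D (γ γ' : {γ : MIdx d // 0 ≤ wt γ}) (n : NN d) (β : MIdx d)
    (h : coeff β (monomial γ.1 (1 : ℝ) * D n (monomial γ'.1 1)) ≠ 0) : 0 ≤ wt β := by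
  have h1 := ((isWeightedHomogeneous_monomial (R := ℝ) varWt γ.1 1 rfl).mul (isHom_D n γ'.1)) h
  rw [← wt_eq, ← wt_eq] at h1
  have := γ.2; have := γ'.2; omega

theorem good_del (γ : {γ : MIdx d // 0 ≤ wt γ}) (i : Fin (d + 1)) (β : MIdx d)
    (h : coeff β (del i (monomial γ.1 (1 : ℝ))) ≠ 0) : 0 ≤ wt β := by
  have h1 := (isHom_del i γ.1) h
  rw [← wt_eq] at h1
  have := γ.2; omega

theorem D_zero_inl (k : ℕ) :
    D (d := d) 0 (X (Sum.inl k)) = ((k : ℝ) + 1) • X (Sum.inl (k + 1)) := by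
  simp [D]

theorem D_zero_inr (m) : D (d := d) 0 (X (Sum.inr m)) = 0 := by
  simp [D]

theorem D_inl {n : NN d} (h : n ≠ 0) (k : ℕ) : D n (X (Sum.inl k)) = 0 := by
  simp [D, h]

theorem D_inr {n : NN d} (h : n ≠ 0) (m) :
    D n (X (Sum.inr m)) = if m.1 = n then 1 else 0 := by
  simp only [D, h, dite_false, pderiv_X, Pi.single_apply, Sum.inr.injEq, Subtype.ext_iff]

theorem del_inl (i : Fin (d + 1)) (k : ℕ) : del i (X (Sum.inl k)) =
    X (shiftVar 0 i) * (((k : ℝ) + 1) • X (Sum.inl (k + 1))) := by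
  simp [del]

theorem del_inr (i : Fin (d + 1)) (m) : del i (X (Sum.inr m)) =
    ((m.1 i : ℝ) + 1) • X (shiftVar m.1 i) := by
  simp [del]

theorem D_comm (n m : NN d) : ⁅D n, D m⁆ = 0 := by
  refine derivation_ext fun v => ?_
  rw [Derivation.commutator_apply, Derivation.coe_zero, Pi.zero_apply]
  rcases v with k | q <;> by_cases hn : n = 0 <;> by_cases hm : m = 0 <;>
    (try subst hn) <;> (try subst hm) <;>
    simp [D_zero_inl, D_zero_inr, D_inl, D_inr, *, apply_ite]

theorem shiftVar_congr {n m : NN d} {i j : Fin (d + 1)} (h : n + unitVec i = m + unitVec j) :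
    shiftVar n i = shiftVar m j := by
  simp only [shiftVar, h]

theorem del_comm (i j : Fin (d + 1)) : ⁅del (d := d) i, del j⁆ = 0 := by
  rcases eq_or_ne i j with rfl | hij
  · exact lie_self _
  have hji : j ≠ i := fun h => hij h.symm
  refine derivation_ext fun v => ?_
  rw [Derivation.commutator_apply, Derivation.coe_zero, Pi.zero_apply]
  rcases v with k | q
  · have h := shiftVar_congr (n := 0 + unitVec j) (m := 0 + unitVec i) (i := i) (j := j)
      (by abel)
    simp only [del_inl, del_inr, Derivation.leibniz, Derivation.map_smul, smul_eq_mul, h,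
      Pi.add_apply, Pi.zero_apply, Pi.single_apply, hij, hji, if_false]
    simp only [smul_eq_C_mul]
    ring
  · have h := shiftVar_congr (n := q.1 + unitVec j) (m := q.1 + unitVec i) (i := i) (j := j)
      (by abel)
    simp only [del_inr, Derivation.map_smul, h, Pi.add_apply, Pi.single_apply, hij, hji, if_false,
      add_zero]
    simp only [smul_eq_C_mul]
    ring

theorem D_del (n : NN d) (i : Fin (d + 1)) :
    ⁅D n, del i⁆ = (n i : ℝ) • D (n - unitVec i) := by
  have key : n i ≠ 0 → n - unitVec i + unitVec i = n := fun h =>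
    tsub_add_cancel_of_le fun j => by
      by_cases hj : j = i
      · subst hj; simpa using Nat.one_le_iff_ne_zero.2 h
      · simp [hj]
  refine derivation_ext fun v => ?_
  rw [Derivation.commutator_apply, Derivation.smul_apply]
  by_cases hn : n = 0
  · subst hn
    rcases v with k | q
    · simp only [del_inl, D_zero_inl, D_zero_inr, Derivation.leibniz, Derivation.map_smul, smul_eq_mul,
        Pi.zero_apply]
      simp [smul_eq_C_mul]
      ring
    · simp [del_inr, D_zero_inr]
  · rcases v with k | q
    · simp only [del_inl, D_inl hn, D_inr hn, Derivation.leibniz, Derivation.map_smul, map_zero, smul_eq_mul,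
        zero_add]
      by_cases h : unitVec i = n
      · subst h
        simp [D_zero_inl]
      · rw [if_neg h]
        by_cases hi : n i = 0
        · simp [hi]
        · have h' : n - unitVec i ≠ 0 := fun h0 => h (by simpa [h0] using key hi)
          simp [D_inl h']
    · simp only [del_inr, D_inr hn, Derivation.map_smul]
      by_cases h : q.1 + unitVec i = n
      · have h2 : n - unitVec i = q.1 := by rw [← h]; simp
        have h3 : D (n - unitVec i) (X (Sum.inr q)) = 1 := by
          rw [h2, D_inr q.2, if_pos rfl]
        have h4 : n i = q.1 i + 1 := by rw [← h]; simp
        rw [if_pos h, h3, h4, apply_ite (del i)]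
        simp
      · rw [if_neg h, apply_ite (del i)]
        by_cases hi : n i = 0
        · simp [hi]
        · by_cases h' : n - unitVec i = 0
          · simp [h', D_zero_inr]
          · have h5 : q.1 ≠ n - unitVec i := fun h0 => h (by rw [h0]; exact key hi)
            simp [D_inr h', h5]

theorem coeff_toDer (x : Space d) (v : Var d) (β : MIdx d) :
    coeff β (toDer x (X v)) = ∑ a ∈ x.support, x a * coeff β (genDer a (X v)) := by
  have h : toDer x (X v) = ∑ a ∈ x.support, x a • genDer a (X v) := by
    have := congrArg (Derivation.coeFnAddMonoidHom (R := ℝ) (A := Poly d) (M := Poly d))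
      (Finsupp.linearCombination_apply ℝ (v := genDer (d := d)) x)
    have := congrFun this (X v)
    rw [Finsupp.sum, map_sum, Finset.sum_apply] at this
    exact this
  rw [h, coeff_sum]
  simp [coeff_smul]

theorem toDer_injective : Function.Injective (toDer (d := d)) := by
  rw [injective_iff_map_eq_zero]
  intro x hx
  have hc : ∀ (v : Var d) (β : MIdx d),
      ∑ a ∈ x.support, x a * coeff β (genDer a (X v)) = 0 := by
    intro v β
    rw [← coeff_toDer, hx]; simp
  have h1 : ∀ i, x (Sum.inr i) = 0 := by
    intro i
    by_contra hne
    let N : ℕ := (x.support.sup fun a => Sum.elim (fun b : TildeIdx d => b.2 0) (fun _ => 0) a) + 1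
    let n : NN d := Pi.single 0 N
    have hn : n ≠ 0 := fun h => by
      have := congrFun h 0
      simp [n, N] at this
    have := hc (Sum.inr ⟨n, hn⟩) (Finsupp.single (shiftVar n i) 1)
    rw [Finset.sum_eq_single (Sum.inr i)] at this
    · simp only [genDer, del_inr, coeff_smul, coeff_X, smul_eq_mul, if_true, mul_one] at this
      rcases mul_eq_zero.1 this with h | h
      · exact hne h
      · have : (0 : ℝ) ≤ (n i : ℝ) := Nat.cast_nonneg _
        linarith
    · rintro (⟨γ, m⟩ | j) hb hj
      · have hm : n ≠ m := fun h => by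
          have h2 : m 0 ≤ N - 1 := by
            simpa [N] using Finset.le_sup
              (f := fun a => Sum.elim (fun b : TildeIdx d => b.2 0) (fun _ => 0) a) hb
          have h3 := congrFun h 0
          simp only [n, Pi.single_eq_same] at h3
          omega
        have : D m (X (Sum.inr ⟨n, hn⟩)) = 0 := by
          by_cases h0 : m = 0
          · rw [h0, D_zero_inr]
          · rw [D_inr h0, if_neg hm]
        simp [genDer, this]
      · have hji : j ≠ i := fun h => hj (by rw [h])
        have : shiftVar n j ≠ shiftVar n i := fun h => by
          simp only [shiftVar, Sum.inr.injEq, Subtype.mk.injEq, add_right_inj] at h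
          have := congrFun h i
          simp [hji.symm] at this
        simp [genDer, del_inr, coeff_smul, coeff_X, Finsupp.single_left_inj, this]
    · intro h
      simp [Finsupp.notMem_support_iff.1 h]
  ext a
  rcases a with ⟨γ, n⟩ | i
  swap
  · exact h1 i
  rw [Finsupp.coe_zero, Pi.zero_apply]
  by_cases hn : n = 0
  · subst hn
    have := hc (Sum.inl 0) (γ.1 + Finsupp.single (Sum.inl 1) 1)
    rw [Finset.sum_eq_single (Sum.inl (γ, 0))] at this
    · simpa [genDer, D_zero_inl, coeff_mul_X] using this
    · rintro (⟨γ', m⟩ | j) hb hj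
      · by_cases h0 : m = 0
        · subst h0
          have hne : γ'.1 ≠ γ.1 := fun h => hj (by rw [Subtype.ext h])
          simp [genDer, D_zero_inl, coeff_mul_X, coeff_monomial, hne]
        · simp [genDer, D_inl h0]
      · simp [h1 j]
    · intro h
      simp [Finsupp.notMem_support_iff.1 h]
  · have := hc (Sum.inr ⟨n, hn⟩) γ.1
    rw [Finset.sum_eq_single (Sum.inl (γ, n))] at this
    · simpa [genDer, D_inr hn] using this
    · rintro (⟨γ', m⟩ | j) hb hj
      · by_cases h0 : m = 0
        · simp [genDer, h0, D_zero_inr]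
        · by_cases hm : n = m
          · subst hm
            have hne : γ'.1 ≠ γ.1 := fun h => hj (by rw [Subtype.ext h])
            simp [genDer, D_inr h0, coeff_monomial, hne]
          · simp [genDer, D_inr h0, hm]
      · simp [h1 j]
    · intro h
      simp [Finsupp.notMem_support_iff.1 h]

@[simp] theorem bilin_single (f : Gen d → Gen d → Space d) (a b : Gen d) (r s : ℝ) :
    bilin f (Finsupp.single a r) (Finsupp.single b s) = r • s • f a b := by
  simp [bilin]

theorem toDer_brGen (a b : Gen d) : toDer (brGen a b) = ⁅genDer a, genDer b⁆ := by
  have hA : ∀ (γ γ' : {γ : MIdx d // 0 ≤ wt γ}) (n m : NN d),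
      toDer (polyD m (monomial γ.1 (1 : ℝ) * D n (monomial γ'.1 1))) =
        (monomial γ.1 (1 : ℝ) * D n (monomial γ'.1 1)) • D m := fun γ γ' n m =>
    toDer_polyD _ _ fun β h => good_mul_D γ γ' n β h
  have hB : ∀ (γ : {γ : MIdx d // 0 ≤ wt γ}) (n : NN d) (i : Fin (d + 1)),
      toDer (polyD n (del i (monomial γ.1 (1 : ℝ)))) = (del i (monomial γ.1 (1 : ℝ))) • D n :=
    fun γ n i => toDer_polyD _ _ fun β h => good_del γ i β h
  have hC : ∀ (γ : {γ : MIdx d // 0 ≤ wt γ}) (n : NN d) (i : Fin (d + 1)),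
      toDer ((n i : ℝ) • zD (γ, n - unitVec i) - polyD n (del i (monomial γ.1 1))) =
        ⁅(monomial γ.1 (1 : ℝ) : Poly d) • D n, del i⁆ := by
    intro γ n i
    rw [map_sub, map_smul, hB, toDer_single, one_smul]
    refine Derivation.ext fun p => ?_
    have h := congrArg (fun E : Derivation ℝ (Poly d) (Poly d) => E p) (D_del n i)
    simp only [Derivation.commutator_apply, Derivation.smul_apply] at h
    simp only [genDer, Derivation.commutator_apply, Derivation.smul_apply, Derivation.sub_apply,
      Derivation.leibniz, smul_eq_mul]
    rw [mul_comm (monomial _ _) (D (n - unitVec i) p), ← smul_mul_assoc, ← h]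
    ring
  rcases a with ⟨γ, n⟩ | i <;> rcases b with ⟨γ', m⟩ | j
  · simp only [brGen, map_sub, hA, genDer]
    refine Derivation.ext fun p => ?_
    have h := congrArg (fun E : Derivation ℝ (Poly d) (Poly d) => E p) (D_comm n m)
    simp only [Derivation.commutator_apply, Derivation.coe_zero, Pi.zero_apply] at h
    simp only [Derivation.commutator_apply, Derivation.smul_apply, Derivation.sub_apply,
      Derivation.leibniz, smul_eq_mul]
    linear_combination (-(monomial γ.1 (1 : ℝ) * monomial γ'.1 (1 : ℝ))) * h
  · exact hC γ n j
  · simp only [brGen]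
    rw [map_neg, hC γ' m i, lie_skew]
    rfl
  · simp only [brGen, map_zero, genDer, del_comm]

theorem toDer_bracket (x y : Space d) : toDer (bilin brGen x y) = ⁅toDer x, toDer y⁆ := by
  refine Derivation.ext fun p => ?_
  rw [Derivation.commutator_apply]
  induction x using Finsupp.induction_linear with
  | zero => simp
  | add x x' hx hx' =>
    simp only [map_add, LinearMap.add_apply, Derivation.add_apply, hx, hx']; abel
  | single a r =>
    induction y using Finsupp.induction_linear with
    | zero => simp
    | add y y' hy hy' => simp only [map_add, Derivation.add_apply, hy, hy']; abel
    | single b s =>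
      rw [bilin_single, map_smul, map_smul, toDer_brGen, toDer_single, toDer_single]
      simp only [Derivation.smul_apply, Derivation.commutator_apply, Derivation.map_smul, smul_sub]
      rw [smul_comm s r]

theorem br_self (x : Space d) : bilin brGen x x = 0 := toDer_injective (by
  rw [toDer_bracket, lie_self, map_zero])

theorem br_jacobi (x y z : Space d) :
    bilin brGen x (bilin brGen y z) =
      bilin brGen (bilin brGen x y) z + bilin brGen y (bilin brGen x z) := toDer_injective (by
  rw [map_add]
  simp only [toDer_bracket]
  refine Derivation.ext fun p => ?_
  simp only [Derivation.commutator_apply, Derivation.add_apply, map_sub]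
  abel)

theorem br₀_skew (x y : Space d) : bilin brGen₀ x y = -bilin brGen₀ y x := by
  induction x using Finsupp.induction_linear with
  | zero => simp
  | add x x' hx hx' => rw [map_add, map_add, LinearMap.add_apply, hx, hx', neg_add]
  | single a r =>
    induction y using Finsupp.induction_linear with
    | zero => simp
    | add y y' hy hy' => rw [map_add, map_add, LinearMap.add_apply, hy, hy', neg_add]
    | single b s =>
      rw [bilin_single, bilin_single, smul_comm s r, ← smul_neg, ← smul_neg]
      rcases a with ⟨γ, n⟩ | i <;> rcases b with ⟨γ', m⟩ | j <;> simp [brGen₀]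

theorem br₀_self (x : Space d) : bilin brGen₀ x x = 0 := self_eq_neg.1 (br₀_skew x x)

theorem br₀_jacobi_gen (a b c : Gen d) :
    bilin brGen₀ (Finsupp.single a 1) (brGen₀ b c) =
      bilin brGen₀ (brGen₀ a b) (Finsupp.single c 1) +
        bilin brGen₀ (Finsupp.single b 1) (brGen₀ a c) := by
  have key : ∀ (γ : {γ : MIdx d // 0 ≤ wt γ}) (n : NN d) (i j : Fin (d + 1)),
      ((n i : ℝ) * ((n - unitVec i : NN d) j : ℝ)) • zD (γ, n - unitVec i - unitVec j) =
        ((n j : ℝ) * ((n - unitVec j : NN d) i : ℝ)) • zD (γ, n - unitVec j - unitVec i) := by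
    intro γ n i j
    rcases eq_or_ne i j with rfl | h
    · rfl
    · have h' : j ≠ i := fun e => h e.symm
      rw [tsub_right_comm]
      simp [h, h', mul_comm]
  rcases a with ⟨γ, n⟩ | i <;> rcases b with ⟨γ', m⟩ | j <;> rcases c with ⟨γ'', q⟩ | k <;>
    simp only [brGen₀, map_zero, LinearMap.zero_apply, map_smul, map_neg, LinearMap.neg_apply,
      LinearMap.smul_apply, bilin_single, smul_zero, neg_zero, add_zero, smul_neg,
      neg_neg, zero_add, smul_smul, one_mul]
  · rw [key, add_neg_cancel]
  · rw [key]
  · rw [key]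

theorem br₀_jacobi (x y z : Space d) :
    bilin brGen₀ x (bilin brGen₀ y z) =
      bilin brGen₀ (bilin brGen₀ x y) z + bilin brGen₀ y (bilin brGen₀ x z) := by
  induction x using Finsupp.induction_linear with
  | zero => simp
  | add x x' hx hx' => simp only [map_add, LinearMap.add_apply, hx, hx']; abel
  | single a r =>
    induction y using Finsupp.induction_linear with
    | zero => simp
    | add y y' hy hy' => simp only [map_add, LinearMap.add_apply, hy, hy']; abel
    | single b s =>
      induction z using Finsupp.induction_linear with
      | zero => simp
      | add z z' hz hz' => simp only [map_add, hz, hz']; abel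
      | single c t =>
        have h := congrArg (fun w => r • s • t • w) (br₀_jacobi_gen a b c)
        have e : ∀ (g : Gen d) (u : ℝ), (Finsupp.single g u : Space d) = u • Finsupp.single g 1 := by
          intro g u; simp
        rw [e a r, e b s, e c t]
        simp only [map_smul, LinearMap.smul_apply, bilin_single, one_smul, smul_add] at h ⊢
        linear_combination (norm := module) h

variable (d)

/-- The Lie algebra `L` with the bracket `[·,·]`. -/
def L : Type := Space d

/-- The Lie algebra `L₀`: the vector space of `L` with the bracket `[·,·]₀`. -/
def L₀ : Type := Space d

instance : AddCommGroup (L d) := inferInstanceAs (AddCommGroup (Space d))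
instance : Module ℝ (L d) := inferInstanceAs (Module ℝ (Space d))
instance : AddCommGroup (L₀ d) := inferInstanceAs (AddCommGroup (Space d))
instance : Module ℝ (L₀ d) := inferInstanceAs (Module ℝ (Space d))

/-- The bracket of `L`. -/
def br : L d →ₗ[ℝ] L d →ₗ[ℝ] L d := bilin (d := d) brGen

/-- The bracket of `L₀`. -/
def br₀ : L₀ d →ₗ[ℝ] L₀ d →ₗ[ℝ] L₀ d := bilin (d := d) brGen₀

instance : LieRing (L d) where
  bracket x y := br d x y
  add_lie x y z := LinearMap.map_add₂ (br d) x y z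
  lie_add x y z := map_add (br d x) y z
  lie_self x := br_self (d := d) x
  leibniz_lie x y z := br_jacobi (d := d) x y z

instance : LieAlgebra ℝ (L d) where
  lie_smul r x y := map_smul (br d x) r y

instance : LieRing (L₀ d) where
  bracket x y := br₀ d x y
  add_lie x y z := LinearMap.map_add₂ (br₀ d) x y z
  lie_add x y z := map_add (br₀ d x) y z
  lie_self x := br₀_self (d := d) x
  leibniz_lie x y z := br₀_jacobi (d := d) x y z

instance : LieAlgebra ℝ (L₀ d) where
  lie_smul r x y := map_smul (br₀ d x) r y

/-- The identification of the common vector space with `L`. -/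
def toL : Space d ≃ₗ[ℝ] L d := LinearEquiv.refl ℝ (Space d)

/-- The identification of the common vector space with `L₀`. -/
def toL₀ : Space d ≃ₗ[ℝ] L₀ d := LinearEquiv.refl ℝ (Space d)

/-- The post-Lie product on `L₀`. -/
def tri₀ : L₀ d →ₗ[ℝ] L₀ d →ₗ[ℝ] L₀ d := bilin (d := d) triGen

/-- The Lie algebra `L` consists of derivations: it is isomorphic, by `z^γ D^{(n)} ↦ z^γ D^{(n)}` and
`∂_i ↦ ∂_i`, to the span of these derivations with the commutator bracket. -/
theorem realisation : ∃ f : L d →ₗ⁅ℝ⁆ Derivation ℝ (Poly d) (Poly d),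
    Function.Injective f ∧ (∀ a, f (toL d (Finsupp.single a 1)) = genDer a) ∧
      LinearMap.range (f : L d →ₗ[ℝ] Derivation ℝ (Poly d) (Poly d)) =
        Submodule.span ℝ (Set.range genDer) :=
  ⟨{ toLinearMap := (toDer : Space d →ₗ[ℝ] _), map_lie' := fun {x y} => toDer_bracket x y },
    toDer_injective, fun a => (toDer_single a 1).trans (one_smul _ _),
    Finsupp.range_linearCombination ℝ⟩

end MultiIndices

end

/-! The triple (`L₀`, `[·,·]₀`, `▷`) is a post-Lie algebra whose composed bracket `[x,y]₀ + x ▷ y -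
y ▷ x` is the bracket of `L`. Everything except the basis holds for any such triple, with `g` for
`L₀` and `gb` for `L`.

Each `x ▷ ·` extends to a derivation of `U(g)`, and `x ↦ (A ↦ x A + x ▷ A)` is a representation of
`gb` on `U(g)` (`starLin_lie`). Applying it to `1` gives `phi : U(gb) → U(g)`. Its inverse comes
from a second module structure: the operators `W_x` (`right`) make `U(gb)` a right `U(g)`-module
(`right_lie_apply`), and `psi` is the action on `1`. Under `phi`, `W_x` becomes right multiplication
by `x` (`phi_right`); under `psi`, the operator `A ↦ x A + x ▷ A` becomes left multiplication by `x`
(`psi_starLin`). Hence the two maps are mutually inverse, with no comparison of graded pieces.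

The product `A ▷ B` on `U(g)` is the action of `psi A` by the algebra generated by the derivations,
and `⋆` is the product of `U(gb)` transported by `phi` (`star_phi`); the Hopf axioms are transported
likewise. Uniqueness rests on `A ▷ 1 = ε(A) 1`, which follows from `1 · 1 = 1` because a convolution
idempotent with value `1` at `1` is the convolution unit.

For the concrete `L₀` the post-Lie axioms hold because `x ▷ ·` acts on the coefficient `p` of `p
D^{(n)}` through the derivation `x`, while `[·,∂_i]₀` changes only `n`. Normally ordered monomials
span `U(L₀)` by commuting each `∂_i` to the left; they are independent because `U(L₀)` acts from the
right on polynomials and sends `1` to distinct monomials. The basis of `U(L)` is their preimage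
under `phi`. -/

noncomputable section

/-! ### Enveloping algebras: induction principles, extension of derivations, convolution -/

namespace UEA

attribute [local instance 100] LieRing.ofAssociativeRing
attribute [-simp] UniversalEnvelopingAlgebra.ι_apply

variable {R : Type*} [CommRing R] {g : Type*} [LieRing g] [LieAlgebra R g]

local notation "U" => UniversalEnvelopingAlgebra R g
local notation "inc" => UniversalEnvelopingAlgebra.ι R (L := g)

theorem inc_lie (x y : g) : inc ⁅x, y⁆ = inc x * inc y - inc y * inc x :=
  LieHom.map_lie _ x y

variable (R g) in
/-- The canonical map `g → U(g)`, as a linear map. -/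
def incLin : g →ₗ[R] U := (inc : g →ₗ[R] U)

@[simp] theorem incLin_apply (x : g) : incLin R g x = inc x := rfl

/-- The algebra morphism on `U(g)` given by a linear map that turns brackets into commutators. -/
def liftLin {A : Type*} [Ring A] [Algebra R A] (f : g →ₗ[R] A)
    (hf : ∀ x y, f ⁅x, y⁆ = f x * f y - f y * f x) : U →ₐ[R] A :=
  UniversalEnvelopingAlgebra.lift R { f with map_lie' := fun {x y} => hf x y }

@[simp] theorem liftLin_inc {A : Type*} [Ring A] [Algebra R A] (f : g →ₗ[R] A)
    (hf : ∀ x y, f ⁅x, y⁆ = f x * f y - f y * f x) (x : g) : liftLin f hf (inc x) = f x := by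
  rw [liftLin, UniversalEnvelopingAlgebra.lift_ι_apply]; rfl

@[elab_as_elim]
theorem induction_left {p : U → Prop} (one : p 1) (add : ∀ a b, p a → p b → p (a + b))
    (smul : ∀ (r : R) a, p a → p (r • a)) (mul : ∀ x a, p a → p (inc x * a)) (a : U) : p a := by
  have ha : a ∈ Algebra.adjoin R (Set.range inc) := by rw [adjoin_range]; trivial
  -- `p` need not be stable under products, but "left multiplication by `a` preserves `p`" is, so it
  -- can be proved by induction over the generated subalgebra.
  suffices h : ∀ b, p b → p (a * b) by simpa using h 1 one
  induction ha using Algebra.adjoin_induction with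
  | mem y hy => obtain ⟨x, rfl⟩ := hy; exact mul x
  | algebraMap r => intro b hb; rw [← Algebra.smul_def]; exact smul r b hb
  | add a a' _ _ ha ha' => intro b hb; rw [add_mul]; exact add _ _ (ha b hb) (ha' b hb)
  | mul a a' _ _ ha ha' => intro b hb; rw [mul_assoc]; exact ha _ (ha' b hb)

@[elab_as_elim]
theorem induction_right {p : U → Prop} (one : p 1) (add : ∀ a b, p a → p b → p (a + b))
    (smul : ∀ (r : R) a, p a → p (r • a)) (mul : ∀ a x, p a → p (a * inc x)) (a : U) : p a := by
  have ha : a ∈ Algebra.adjoin R (Set.range inc) := by rw [adjoin_range]; trivial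
  suffices h : ∀ b, p b → p (b * a) by simpa using h 1 one
  induction ha using Algebra.adjoin_induction with
  | mem y hy => obtain ⟨x, rfl⟩ := hy; exact fun b hb => mul b x hb
  | algebraMap r =>
    intro b hb; rw [← Algebra.commutes, ← Algebra.smul_def]; exact smul r b hb
  | add a a' _ _ ha ha' => intro b hb; rw [mul_add]; exact add _ _ (ha b hb) (ha' b hb)
  | mul a a' _ _ ha ha' => intro b hb; rw [← mul_assoc]; exact ha' _ (ha b hb)

theorem comul_inc (x : g) :
    Coalgebra.comul (R := R) (inc x) = inc x ⊗ₜ[R] 1 + 1 ⊗ₜ[R] inc x :=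
  comulHom_inc R x

theorem counit_inc (x : g) : Coalgebra.counit (R := R) (inc x) = 0 :=
  counitHom_inc R x

/-- Linear maps `F` with `F (a b) = (F a) b + a (F b)`. -/
def IsDer {A : Type*} [Ring A] [Algebra R A] (F : A →ₗ[R] A) : Prop :=
  ∀ a b, F (a * b) = F a * b + a * F b

theorem IsDer.map_one {A : Type*} [Ring A] [Algebra R A] {F : A →ₗ[R] A} (h : IsDer F) :
    F 1 = 0 := by
  have := h 1 1
  simpa using this

theorem IsDer.ext {F G : U →ₗ[R] U} (hF : IsDer F) (hG : IsDer G)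
    (h : ∀ x, F (inc x) = G (inc x)) : F = G := by
  ext a
  induction a using induction_left with
  | one => rw [hF.map_one, hG.map_one]
  | add a b ha hb => rw [map_add, map_add, ha, hb]
  | smul r a ha => rw [map_smul, map_smul, ha]
  | mul x a ha => rw [hF, hG, ha, h]

/-- A derivation of a Lie algebra, as an algebra morphism to the dual numbers over `U(g)`. -/
def derDual (δ : g →ₗ[R] g) (hδ : ∀ x y, δ ⁅x, y⁆ = ⁅δ x, y⁆ + ⁅x, δ y⁆) :
    U →ₐ[R] TrivSqZeroExt U U :=
  liftLin
    { toFun := fun x => TrivSqZeroExt.inl (inc x) + TrivSqZeroExt.inr (inc (δ x))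
      map_add' := fun x y => by ext <;> simp
      map_smul' := fun r x => by ext <;> simp }
    (fun x y => by
      ext
      · simp [LieRing.of_associative_ring_bracket]
      · simp [LieRing.of_associative_ring_bracket, hδ]; abel)

/-- The extension of a derivation of a Lie algebra to its enveloping algebra. -/
def derExt (δ : g →ₗ[R] g) (hδ : ∀ x y, δ ⁅x, y⁆ = ⁅δ x, y⁆ + ⁅x, δ y⁆) : U →ₗ[R] U where
  toFun a := (derDual δ hδ a).snd
  map_add' a b := by simp
  map_smul' r a := by simp

/-- An algebra morphism to the dual numbers has a second component that is a derivation relative to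
the first; since the first is the identity, `derExt` satisfies the plain Leibniz rule. -/
theorem derDual_fst (δ : g →ₗ[R] g) (hδ : ∀ x y, δ ⁅x, y⁆ = ⁅δ x, y⁆ + ⁅x, δ y⁆) (a : U) :
    (derDual δ hδ a).fst = a := by
  induction a using induction_left with
  | one => simp
  | add a b ha hb => simp [ha, hb]
  | smul r a ha => simp [ha]
  | mul x a ha => rw [map_mul, TrivSqZeroExt.fst_mul, ha]; simp [derDual]

theorem isDer_derExt (δ : g →ₗ[R] g) (hδ : ∀ x y, δ ⁅x, y⁆ = ⁅δ x, y⁆ + ⁅x, δ y⁆) :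
    IsDer (derExt δ hδ) := fun a b => by
  simp [derExt, derDual_fst, add_comm]

@[simp] theorem derExt_inc (δ : g →ₗ[R] g) (hδ : ∀ x y, δ ⁅x, y⁆ = ⁅δ x, y⁆ + ⁅x, δ y⁆) (x : g) :
    derExt δ hδ (inc x) = inc (δ x) := by
  simp [derExt, derDual]

/-! ### The degree filtration -/

theorem comul_inc_mul (x : g) (a : U) :
    Coalgebra.comul (R := R) (inc x * a) =
      (inc x ⊗ₜ[R] 1 + 1 ⊗ₜ[R] inc x) * Coalgebra.comul (R := R) a := by
  rw [Bialgebra.comul_mul, comul_inc]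

variable (R g) in
/-- The filtration of the enveloping algebra by the degree. -/
def filt (n : ℕ) : Submodule R U := (1 ⊔ LinearMap.range (incLin R g)) ^ n

theorem one_mem_filt_one : (1 : U) ∈ filt R g 1 := by
  rw [filt, pow_one]
  exact Submodule.mem_sup_left (Submodule.mem_one.2 ⟨1, map_one _⟩)

theorem inc_mem_filt_one (x : g) : inc x ∈ filt R g 1 := by
  rw [filt, pow_one]
  exact Submodule.mem_sup_right ⟨x, rfl⟩

theorem mul_mem_filt {i j : ℕ} {a b : U} (ha : a ∈ filt R g i) (hb : b ∈ filt R g j) :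
    a * b ∈ filt R g (i + j) := by
  rw [filt, pow_add]
  exact Submodule.mul_mem_mul ha hb

theorem filt_mono : Monotone (filt R g) := monotone_nat_of_le_succ fun n a ha => by
  simpa [add_comm] using mul_mem_filt one_mem_filt_one ha

theorem exists_mem_filt (a : U) : ∃ n, a ∈ filt R g n := by
  induction a using induction_left with
  | one => exact ⟨1, one_mem_filt_one⟩
  | add a b ha hb =>
    obtain ⟨i, hi⟩ := ha
    obtain ⟨j, hj⟩ := hb
    exact ⟨max i j, add_mem (filt_mono (le_max_left i j) hi) (filt_mono (le_max_right i j) hj)⟩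
  | smul r a ha =>
    obtain ⟨i, hi⟩ := ha
    exact ⟨i, Submodule.smul_mem _ r hi⟩
  | mul x a ha =>
    obtain ⟨i, hi⟩ := ha
    exact ⟨1 + i, mul_mem_filt (inc_mem_filt_one x) hi⟩

variable (R g) in
/-- The filtration of the tensor square of the enveloping algebra by the total degree. -/
def filtTensor (n : ℕ) : Submodule R (U ⊗[R] U) :=
  Submodule.span R {t | ∃ i j a b, i + j = n ∧ a ∈ filt R g i ∧ b ∈ filt R g j ∧ t = a ⊗ₜ[R] b}

theorem filtTensor_mul_le (m n : ℕ) :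
    filtTensor R g m * filtTensor R g n ≤ filtTensor R g (m + n) := by
  rw [filtTensor, filtTensor, Submodule.span_mul_span, Submodule.span_le]
  rintro _ ⟨_, ⟨i, j, a, b, hij, ha, hb, rfl⟩, _, ⟨i', j', a', b', hij', ha', hb', rfl⟩, rfl⟩
  refine Submodule.subset_span ⟨i + i', j + j', a * a', b * b', by omega, mul_mem_filt ha ha',
    mul_mem_filt hb hb', ?_⟩
  simp

/-- The coproduct is multiplicative and maps scalars and primitive generators to total degree at
most one. This bound allows convolution arguments by induction on the degree. -/
theorem comul_mem_filtTensor (n : ℕ) : ∀ a ∈ filt R g n,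
    Coalgebra.comul (R := R) a ∈ filtTensor R g n := by
  have h0 : (1 : U) ∈ filt R g 0 := by rw [filt, pow_zero]; exact Submodule.mem_one.2 ⟨1, map_one _⟩
  have h1 : ∀ a ∈ filt R g 1, Coalgebra.comul (R := R) a ∈ filtTensor R g 1 := by
    intro a ha
    rw [filt, pow_one] at ha
    obtain ⟨_, hb, _, ⟨x, rfl⟩, rfl⟩ := Submodule.mem_sup.1 ha
    obtain ⟨r, rfl⟩ := Submodule.mem_one.1 hb
    rw [map_add, Algebra.algebraMap_eq_smul_one, map_smul, Bialgebra.comul_one, incLin_apply,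
      comul_inc]
    refine add_mem (Submodule.smul_mem _ _ ?_) (add_mem ?_ ?_) <;> refine Submodule.subset_span ?_
    · exact ⟨1, 0, 1, 1, rfl, one_mem_filt_one, h0, rfl⟩
    · exact ⟨1, 0, _, 1, rfl, inc_mem_filt_one x, h0, rfl⟩
    · exact ⟨0, 1, 1, _, rfl, h0, inc_mem_filt_one x, rfl⟩
  induction n with
  | zero =>
    intro a ha
    rw [filt, pow_zero] at ha
    obtain ⟨r, rfl⟩ := Submodule.mem_one.1 ha
    rw [Algebra.algebraMap_eq_smul_one, map_smul, Bialgebra.comul_one]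
    exact Submodule.smul_mem _ _ (Submodule.subset_span ⟨0, 0, 1, 1, rfl, h0, h0, rfl⟩)
  | succ n ih =>
    intro a ha
    rw [filt, pow_succ] at ha
    induction ha using Submodule.mul_induction_on' with
    | mem_mul_mem a ha b hb =>
      rw [Bialgebra.comul_mul]
      exact filtTensor_mul_le n 1 (Submodule.mul_mem_mul (ih a ha)
        (h1 b (by rw [filt, pow_one]; exact hb)))
    | add a _ b _ ha hb => rw [map_add]; exact add_mem ha hb

/-- A linear map that is idempotent for the convolution product and maps `1` to `1` is the unit of
the convolution product. -/
theorem eq_counit_of_conv_idempotent {A : Type*} [Ring A] [Algebra R A] (E : U →ₗ[R] A)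
    (h1 : E 1 = 1)
    (hE : ∀ a, E a = LinearMap.mul' R A (TensorProduct.map E E (Coalgebra.comul (R := R) a)))
    (a : U) : E a = Coalgebra.counit (R := R) a • (1 : A) := by
  let η : U →ₗ[R] A := LinearMap.toSpanSingleton R A 1 ∘ₗ Coalgebra.counit
  have hη : ∀ a, η a = Coalgebra.counit (R := R) a • (1 : A) := fun a => rfl
  have hr : ∀ F : U →ₗ[R] A, ∀ a,
      LinearMap.mul' R A (TensorProduct.map F η (Coalgebra.comul (R := R) a)) = F a := by
    intro F a
    have : ∀ t : U ⊗[R] U, LinearMap.mul' R A (TensorProduct.map F η t) =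
        F (TensorProduct.rid R U (Coalgebra.counit.lTensor U t)) := by
      intro t
      induction t with
      | zero => simp
      | add s t hs ht => simp only [map_add, hs, ht]
      | tmul b c => simp [hη]
    rw [this, Coalgebra.lTensor_counit_comul]
    simp
  have hl : ∀ F : U →ₗ[R] A, ∀ a,
      LinearMap.mul' R A (TensorProduct.map η F (Coalgebra.comul (R := R) a)) = F a := by
    intro F a
    have : ∀ t : U ⊗[R] U, LinearMap.mul' R A (TensorProduct.map η F t) =
        F (TensorProduct.lid R U (Coalgebra.counit.rTensor U t)) := by
      intro t
      induction t with
      | zero => simp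
      | add s t hs ht => simp only [map_add, hs, ht]
      | tmul b c => simp [hη]
    rw [this, Coalgebra.rTensor_counit_comul]
    simp
  -- With `η` the convolution unit and `f = E - η`, idempotence gives `f * f = E - 2E + η = -f`.
  have hf : ∀ a, LinearMap.mul' R A
      (TensorProduct.map (E - η) (E - η) (Coalgebra.comul (R := R) a)) = -(E - η) a := by
    intro a
    have hsub : TensorProduct.map (E - η) (E - η) = TensorProduct.map E E - TensorProduct.map E η -
        TensorProduct.map η E + TensorProduct.map η η := by
      refine TensorProduct.ext' fun a b => ?_
      simp only [TensorProduct.map_tmul, LinearMap.sub_apply, LinearMap.add_apply,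
        TensorProduct.sub_tmul, TensorProduct.tmul_sub]
      abel
    rw [hsub]
    simp only [LinearMap.sub_apply, LinearMap.add_apply, map_sub, map_add, hr, hl, ← hE]
    abel
  have h0 : (E - η) 1 = 0 := by simp [h1, hη]
  -- As `f = -(f * f)`, each term of `Δ a` contributes `f b · f c`. Either `b` has degree below `n`,
  -- or `c` has degree `0`, where `f` vanishes since `f 1 = 0`.
  have key : ∀ n, ∀ a ∈ filt R g n, (E - η) a = 0 := by
    intro n
    induction n using Nat.strong_induction_on with
    | _ n ih =>
      intro a ha
      have hz : ∀ a ∈ filt R g 0, (E - η) a = 0 := by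
        intro a ha
        rw [filt, pow_zero] at ha
        obtain ⟨r, rfl⟩ := Submodule.mem_one.1 ha
        rw [Algebra.algebraMap_eq_smul_one, map_smul, h0, smul_zero]
      rcases Nat.eq_zero_or_pos n with rfl | hn
      · exact hz a ha
      · rw [← neg_eq_zero, ← hf]
        have := comul_mem_filtTensor n a ha
        refine (Submodule.span_le (p := LinearMap.ker (LinearMap.mul' R A ∘ₗ
          TensorProduct.map (E - η) (E - η)))).2 ?_ this
        rintro _ ⟨i, j, b, c, hij, hb, hc, rfl⟩
        change LinearMap.mul' R A (TensorProduct.map (E - η) (E - η) (b ⊗ₜ[R] c)) = 0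
        rw [TensorProduct.map_tmul, LinearMap.mul'_apply]
        rcases lt_or_ge i n with hi | hi
        · rw [ih i hi b hb, zero_mul]
        · obtain rfl : j = 0 := by omega
          rw [hz c hc, mul_zero]
  obtain ⟨n, hn⟩ := exists_mem_filt a
  exact sub_eq_zero.1 (key n a hn)

end UEA

/-! ### Post-Lie algebras: the isomorphism `phi` and the products `▷` and `⋆` -/

namespace PostLie

open UniversalEnvelopingAlgebra UEA

attribute [-simp] UniversalEnvelopingAlgebra.ι_apply

variable {g : Type*} [LieRing g] [LieAlgebra ℝ g] {gb : Type*} [LieRing gb] [LieAlgebra ℝ gb]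

local notation "U" => UniversalEnvelopingAlgebra ℝ g
local notation "Ub" => UniversalEnvelopingAlgebra ℝ gb

/-- `tri` is a post-Lie product on the Lie algebra `g`, and `e` identifies `gb` with the vector
space `g` with the composed bracket `[x, y] + x ▷ y - y ▷ x`. -/
structure IsPostLie (tri : g →ₗ[ℝ] g →ₗ[ℝ] g) (e : gb ≃ₗ[ℝ] g) : Prop where
  tri_lie : ∀ x y z : g, tri x ⁅y, z⁆ = ⁅tri x y, z⁆ + ⁅y, tri x z⁆
  lie_tri : ∀ (x y : gb) (z : g),
    tri (e ⁅x, y⁆) z = tri (e x) (tri (e y) z) - tri (e y) (tri (e x) z)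
  e_lie : ∀ x y : gb, e ⁅x, y⁆ = ⁅e x, e y⁆ + tri (e x) (e y) - tri (e y) (e x)

variable {tri : g →ₗ[ℝ] g →ₗ[ℝ] g} {e : gb ≃ₗ[ℝ] g}

variable (tri e) in
/-- The action of `gb` on the linear maps `f : g → U(gb)` by `(y f)(x) = y f(x) - f(y ▷ x)`. -/
def homAct : gb →ₗ[ℝ] Module.End ℝ (g →ₗ[ℝ] Ub) :=
  LinearMap.mk₂ ℝ (fun y f => LinearMap.mulLeft ℝ (ι ℝ y) ∘ₗ f - f ∘ₗ tri (e y))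
    (fun y y' f => by
      ext x
      simp only [map_add, LinearMap.sub_apply, LinearMap.add_apply, LinearMap.comp_apply,
        LinearMap.mulLeft_apply, add_mul]
      abel)
    (fun r y f => by
      ext x
      simp [smul_sub])
    (fun y f f' => by
      ext x
      simp only [LinearMap.sub_apply, LinearMap.add_apply, LinearMap.comp_apply,
        LinearMap.mulLeft_apply, mul_add]
      abel)
    (fun r y f => by
      ext x
      simp [smul_sub])

theorem homAct_apply (y : gb) (f : g →ₗ[ℝ] Ub) (x : g) :
    homAct tri e y f x = ι ℝ y * f x - f (tri (e y) x) := rfl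

namespace IsPostLie

variable (h : IsPostLie tri e)
include h

/-- The derivations `x ▷ ·` of `U(g)`. -/
def derLin : gb →ₗ[ℝ] Module.End ℝ U where
  toFun x := derExt (tri (e x)) (h.tri_lie (e x))
  map_add' x y := IsDer.ext (isDer_derExt _ _)
    (fun a b => by
      simp only [LinearMap.add_apply, isDer_derExt _ _ a b, add_mul, mul_add]; abel)
    (fun z => by simp)
  map_smul' r x := IsDer.ext (isDer_derExt _ _)
    (fun a b => by
      simp only [LinearMap.smul_apply, isDer_derExt _ _ a b, RingHom.id_apply, smul_add,
        smul_mul_assoc, mul_smul_comm])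
    (fun z => by simp)

@[simp] theorem derLin_inc (x : gb) (z : g) : h.derLin x (ι ℝ z) = ι ℝ (tri (e x) z) :=
  derExt_inc _ _ z

theorem derLin_mul (x : gb) (a b : U) :
    h.derLin x (a * b) = h.derLin x a * b + a * h.derLin x b :=
  isDer_derExt _ _ a b

@[simp] theorem derLin_one (x : gb) : h.derLin x 1 = 0 := (isDer_derExt _ _).map_one

theorem derLin_lie (x y : gb) :
    h.derLin ⁅x, y⁆ = h.derLin x * h.derLin y - h.derLin y * h.derLin x := by
  refine IsDer.ext (h.derLin_mul _) (fun a b => ?_) (fun z => ?_)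
  · simp only [LinearMap.sub_apply, Module.End.mul_apply, h.derLin_mul, map_add, sub_mul, mul_sub]
    abel
  · simp [h.lie_tri]

/-- The action of `U(gb)` on `U(g)` extending the derivations `x ▷ ·`. -/
def rho : Ub →ₐ[ℝ] Module.End ℝ U := liftLin h.derLin h.derLin_lie

@[simp] theorem rho_inc (x : gb) : h.rho (ι ℝ x) = h.derLin x := liftLin_inc _ _ x

/-- The operators `A ↦ x A + x ▷ A` on `U(g)`. -/
def starLin : gb →ₗ[ℝ] Module.End ℝ U :=
  (LinearMap.mul ℝ U) ∘ₗ incLin ℝ g ∘ₗ e.toLinearMap + h.derLin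

theorem starLin_apply (x : gb) (a : U) :
    h.starLin x a = ι ℝ (e x) * a + h.derLin x a := rfl

/-- The commutator of `x·` and `y ▷ ·` is left multiplication by `-(y ▷ x)`; these cross terms are
exactly what separates the composed bracket from that of `g`. -/
theorem starLin_lie (x y : gb) :
    h.starLin ⁅x, y⁆ = h.starLin x * h.starLin y - h.starLin y * h.starLin x := by
  ext a
  simp only [LinearMap.sub_apply, Module.End.mul_apply, starLin_apply, h.derLin_lie, h.e_lie,
    map_sub, map_add, inc_lie, h.derLin_mul, derLin_inc]
  noncomm_ring

/-- The action of `U(gb)` on `U(g)` extending `A ↦ x A + x ▷ A`. -/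
def sigma : Ub →ₐ[ℝ] Module.End ℝ U := liftLin h.starLin h.starLin_lie

@[simp] theorem sigma_inc (x : gb) : h.sigma (ι ℝ x) = h.starLin x := liftLin_inc _ _ x

/-- The canonical map `U(gb) → U(g)`. -/
def phi : Ub →ₗ[ℝ] U := LinearMap.applyₗ (1 : U) ∘ₗ h.sigma.toLinearMap

theorem phi_apply (a : Ub) : h.phi a = h.sigma a 1 := rfl

theorem phi_mul (a b : Ub) : h.phi (a * b) = h.sigma a (h.phi b) := by
  simp [phi_apply]

@[simp] theorem phi_one : h.phi 1 = 1 := by simp [phi_apply]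

theorem phi_inc_mul (x : gb) (a : Ub) :
    h.phi (ι ℝ x * a) = ι ℝ (e x) * h.phi a + h.derLin x (h.phi a) := by
  rw [phi_mul, sigma_inc, starLin_apply]

@[simp] theorem phi_inc (x : gb) : h.phi (ι ℝ x) = ι ℝ (e x) := by
  simpa using h.phi_inc_mul x 1

/-! ### Right multiplication on `U(gb)` -/

/-- The recursion for `W_x (y A)` involves `W` at another subscript, so all `W_x` are built at once,
as the map `A ↦ (x ↦ W_x A)` into Hom(`g`, `U(gb)`). It is the orbit map of the inclusion under the
action of `U(gb)`; the present identity makes the recursion consistent with the relations of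
`U(gb)`. -/
theorem homAct_lie (x y : gb) :
    homAct tri e ⁅x, y⁆ =
      homAct tri e x * homAct tri e y - homAct tri e y * homAct tri e x := by
  ext f z
  simp only [LinearMap.sub_apply, Module.End.mul_apply, homAct_apply, h.lie_tri, inc_lie, map_sub]
  noncomm_ring

/-- The operators `W_x` on `U(gb)`. -/
def right : g →ₗ[ℝ] Module.End ℝ Ub :=
  (LinearMap.applyₗ (incLin ℝ gb ∘ₗ e.symm.toLinearMap) ∘ₗ
    (liftLin (homAct tri e) h.homAct_lie).toLinearMap).flip

@[simp] theorem right_one (x : g) : h.right x 1 = ι ℝ (e.symm x) := by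
  simp [right]

theorem right_inc_mul (x : g) (y : gb) (a : Ub) :
    h.right x (ι ℝ y * a) = ι ℝ y * h.right x a - h.right (tri (e y) x) a := by
  simp [right, homAct_apply]

/-- The order is reversed because these operators model right multiplications. At `1` the identity
is the formula for the composed bracket, using `W_y x = x y - x ▷ y`; passing from `a` to `z a` uses
that `z ▷ ·` is a derivation of the bracket of `g`. -/
theorem right_lie_apply (a : Ub) : ∀ x y : g,
    h.right ⁅x, y⁆ a = h.right y (h.right x a) - h.right x (h.right y a) := by
  induction a using induction_left with
  | one =>
    intro x y
    have h1 := h.e_lie (e.symm x) (e.symm y)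
    simp only [LinearEquiv.apply_symm_apply] at h1
    have h2 : ⁅x, y⁆ = e ⁅e.symm x, e.symm y⁆ - tri x y + tri y x := by rw [h1]; abel
    have h3 : ∀ x y : g, h.right y (ι ℝ (e.symm x)) =
        ι ℝ (e.symm x) * ι ℝ (e.symm y) - ι ℝ (e.symm (tri x y)) := fun x y => by
      simpa using h.right_inc_mul y (e.symm x) 1
    rw [right_one, right_one, right_one, h2, h3, h3]
    simp only [map_add, map_sub, LinearEquiv.symm_apply_apply, inc_lie]
    abel
  | add a b ha hb => intro x y; simp only [map_add, ha, hb]; abel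
  | smul r a ha => intro x y; simp only [map_smul, ha, smul_sub]
  | mul z a ha =>
    intro x y
    simp only [right_inc_mul, map_sub, ha, h.tri_lie, map_add, LinearMap.add_apply, mul_sub]
    abel

/-- The right action of `U(g)` on `U(gb)` given by the operators `W_x`. -/
def rightAct : U →ₐ[ℝ] (Module.End ℝ Ub)ᵐᵒᵖ :=
  liftLin ((MulOpposite.opLinearEquiv ℝ).toLinearMap ∘ₗ h.right) (fun x y => by
    simp only [LinearMap.comp_apply, LinearEquiv.coe_coe, MulOpposite.coe_opLinearEquiv,
      ← MulOpposite.op_mul, ← MulOpposite.op_sub]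
    congr 1
    ext a
    exact h.right_lie_apply a x y)

/-- The inverse `U(g) → U(gb)` of the canonical map. -/
def psi : U →ₗ[ℝ] Ub :=
  LinearMap.applyₗ (1 : Ub) ∘ₗ (MulOpposite.opLinearEquiv ℝ).symm.toLinearMap ∘ₗ
    h.rightAct.toLinearMap

@[simp] theorem psi_one : h.psi 1 = 1 := by simp [psi]

theorem psi_mul_inc (a : U) (x : g) : h.psi (a * ι ℝ x) = h.right x (h.psi a) := by
  simp [psi, rightAct]

/-- Both sides obey the same recursion in `a`, because `z ⋆ (B x) = (z ⋆ B) x + B (z ▷ x)` for a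
letter `z`. -/
theorem phi_right (x : g) (a : Ub) : h.phi (h.right x a) = h.phi a * ι ℝ x := by
  induction a using induction_left generalizing x with
  | one => simp
  | add a b ha hb => simp only [map_add, ha, hb, add_mul]
  | smul r a ha => simp only [map_smul, ha, smul_mul_assoc]
  | mul z a ha =>
    rw [right_inc_mul, map_sub, phi_inc_mul, phi_inc_mul, ha, ha, derLin_mul, derLin_inc]
    noncomm_ring

theorem phi_psi (a : U) : h.phi (h.psi a) = a := by
  induction a using induction_right with
  | one => simp
  | add a b ha hb => simp only [map_add, ha, hb]
  | smul r a ha => simp only [map_smul, ha]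
  | mul a x ha => rw [psi_mul_inc, phi_right, ha]

/-- Mirror image of `phi_right`: letters are now peeled off on the right, and the term in `y ▷ x`
cancels the correction in the recursion for `W_x`. -/
theorem psi_starLin (y : gb) (a : U) : h.psi (h.starLin y a) = ι ℝ y * h.psi a := by
  induction a using induction_right with
  | one =>
    have := h.psi_mul_inc 1 (e y)
    simpa [starLin_apply] using this
  | add a b ha hb => simp only [map_add, ha, hb, mul_add]
  | smul r a ha => simp only [map_smul, ha, mul_smul_comm]
  | mul a x ha =>
    have h1 : h.starLin y (a * ι ℝ x) = h.starLin y a * ι ℝ x + a * ι ℝ (tri (e y) x) := by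
      simp only [starLin_apply, derLin_mul, derLin_inc]; noncomm_ring
    rw [h1, map_add, psi_mul_inc, psi_mul_inc, psi_mul_inc, ha, right_inc_mul, sub_add_cancel]

theorem psi_phi (a : Ub) : h.psi (h.phi a) = a := by
  induction a using induction_left with
  | one => simp
  | add a b ha hb => simp only [map_add, ha, hb]
  | smul r a ha => simp only [map_smul, ha]
  | mul x a ha => rw [phi_mul, sigma_inc, psi_starLin, ha]

/-! ### Compatibility with the coproduct, and the product `⋆` -/

/-- The derivation of `U(g) ⊗ U(g)` induced by `x ▷ ·`. -/
def derTensor (x : gb) : U ⊗[ℝ] U →ₗ[ℝ] U ⊗[ℝ] U :=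
  (h.derLin x).rTensor U + (h.derLin x).lTensor U

@[simp] theorem derTensor_tmul (x : gb) (a b : U) :
    h.derTensor x (a ⊗ₜ[ℝ] b) = h.derLin x a ⊗ₜ[ℝ] b + a ⊗ₜ[ℝ] h.derLin x b := rfl

theorem isDer_derTensor (x : gb) : IsDer (h.derTensor x) := by
  intro s t
  induction s with
  | zero => simp
  | add s s' hs hs' => simp only [add_mul, map_add, hs, hs']; abel
  | tmul a b =>
    induction t with
    | zero => simp
    | add t t' ht ht' => simp only [mul_add, map_add, ht, ht']; abel
    | tmul a' b' =>
      simp only [Algebra.TensorProduct.tmul_mul_tmul, derTensor_tmul, derLin_mul,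
        TensorProduct.add_tmul, TensorProduct.tmul_add, add_mul, mul_add]
      abel

theorem comul_derLin (x : gb) (a : U) : Coalgebra.comul (R := ℝ) (h.derLin x a) =
    h.derTensor x (Coalgebra.comul (R := ℝ) a) := by
  induction a using induction_left with
  | one =>
    rw [derLin_one, map_zero, Bialgebra.comul_one, (h.isDer_derTensor x).map_one]
  | add a b ha hb => simp only [map_add, ha, hb]
  | smul r a ha => simp only [map_smul, ha]
  | mul z a ha =>
    rw [derLin_mul, map_add, derLin_inc, comul_inc_mul, Bialgebra.comul_mul (R := ℝ) (ι ℝ z), ha,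
      comul_inc_mul, h.isDer_derTensor x, comul_inc]
    simp

/-- Both left multiplication by a primitive element and `x ▷ ·` are coderivations, hence so is their
sum, which `phi` intertwines with left multiplication by `x` on `U(gb)`. -/
theorem comul_phi (a : Ub) : Coalgebra.comul (R := ℝ) (h.phi a) =
    TensorProduct.map h.phi h.phi (Coalgebra.comul (R := ℝ) a) := by
  have key : ∀ (x : gb) (t : Ub ⊗[ℝ] Ub),
      TensorProduct.map h.phi h.phi ((ι ℝ x ⊗ₜ[ℝ] 1 + 1 ⊗ₜ[ℝ] ι ℝ x) * t) =
        (ι ℝ (e x) ⊗ₜ[ℝ] 1 + 1 ⊗ₜ[ℝ] ι ℝ (e x)) * TensorProduct.map h.phi h.phi t +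
          h.derTensor x (TensorProduct.map h.phi h.phi t) := by
    intro x t
    induction t with
    | zero => simp
    | add s t hs ht => simp only [mul_add, map_add, hs, ht]; abel
    | tmul a b =>
      simp only [add_mul, map_add, Algebra.TensorProduct.tmul_mul_tmul, one_mul,
        TensorProduct.map_tmul, phi_inc_mul, TensorProduct.add_tmul, TensorProduct.tmul_add,
        derTensor_tmul]
      abel
  induction a using induction_left with
  | one => simp [Algebra.TensorProduct.one_def]
  | add a b ha hb => simp only [map_add, ha, hb]
  | smul r a ha => simp only [map_smul, ha]
  | mul x a ha =>
    rw [comul_inc_mul, key, phi_inc_mul, map_add, comul_inc_mul, comul_derLin, ha]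

theorem counit_derLin (x : gb) (a : U) : Coalgebra.counit (R := ℝ) (h.derLin x a) = 0 := by
  induction a using induction_left with
  | one => simp
  | add a b ha hb => simp only [map_add, ha, hb, add_zero]
  | smul r a ha => simp only [map_smul, ha, smul_zero]
  | mul z a ha => simp [derLin_mul, ha, counit_inc]

theorem counit_phi (a : Ub) :
    Coalgebra.counit (R := ℝ) (h.phi a) = Coalgebra.counit (R := ℝ) a := by
  induction a using induction_left with
  | one => simp
  | add a b ha hb => simp only [map_add, ha, hb]
  | smul r a ha => simp only [map_smul, ha]
  | mul z a ha => simp [phi_inc_mul, counit_inc, h.counit_derLin]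

/-- The canonical isomorphism of coalgebras `U(gb) → U(g)`. -/
def phiEquiv : Ub ≃ₗc[ℝ] U where
  toLinearMap := h.phi
  invFun := h.psi
  left_inv := h.psi_phi
  right_inv := h.phi_psi
  counit_comp := LinearMap.ext h.counit_phi
  map_comp_comul := LinearMap.ext fun a => (h.comul_phi a).symm

/-- The extension of the post-Lie product to `U(g)`. -/
def ext : U →ₗ[ℝ] U →ₗ[ℝ] U := h.rho.toLinearMap ∘ₗ h.psi

/-- Identities for `ext` are checked at `phi a`, where they become statements about the algebra
morphism `rho`. -/
theorem ext_phi (a : Ub) : h.ext (h.phi a) = h.rho a := by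
  simp [ext, psi_phi]

theorem ext_inc (x : gb) : h.ext (ι ℝ (e x)) = h.derLin x := by
  rw [← h.phi_inc, ext_phi, rho_inc]

/-- A Lie algebra acting by derivations makes the algebra a module algebra over its enveloping
algebra; the Leibniz rule is the case of one letter. -/
theorem rho_apply_mul (a : Ub) (B C : U) : h.rho a (B * C) =
    LinearMap.mul' ℝ U (TensorProduct.map (h.rho.toLinearMap.flip B) (h.rho.toLinearMap.flip C)
      (Coalgebra.comul (R := ℝ) a)) := by
  have key : ∀ (x : gb) (t : Ub ⊗[ℝ] Ub),
      LinearMap.mul' ℝ U (TensorProduct.map (h.rho.toLinearMap.flip B)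
        (h.rho.toLinearMap.flip C) ((ι ℝ x ⊗ₜ[ℝ] 1 + 1 ⊗ₜ[ℝ] ι ℝ x) * t)) =
      h.derLin x (LinearMap.mul' ℝ U (TensorProduct.map (h.rho.toLinearMap.flip B)
        (h.rho.toLinearMap.flip C) t)) := by
    intro x t
    induction t with
    | zero => simp
    | add s t hs ht => simp only [mul_add, map_add, hs, ht]
    | tmul a b => simp [add_mul, derLin_mul]
  induction a using induction_left with
  | one => simp [Algebra.TensorProduct.one_def]
  | add a b ha hb => simp only [map_add, LinearMap.add_apply, ha, hb]
  | smul r a ha => simp only [map_smul, LinearMap.smul_apply, ha]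
  | mul x a ha => rw [comul_inc_mul, key, ← ha]; simp

theorem isExtension_ext : IsExtension tri h.ext where
  extend x y := by
    obtain ⟨x, rfl⟩ := e.surjective x
    rw [ext_inc, derLin_inc]
  gen_one x := by
    obtain ⟨x, rfl⟩ := e.surjective x
    rw [ext_inc, derLin_one]
  one_left A := by simp [ext]
  gen_mul_left x A y := by
    obtain ⟨x, rfl⟩ := e.surjective x
    -- Concatenation is written as `x A = x ⋆ A - x ▷ A`, since `ext` is multiplicative for `⋆`.
    have h1 : ι ℝ (e x) * A = h.phi (ι ℝ x * h.psi A) - h.derLin x A := by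
      rw [phi_inc_mul, phi_psi, add_sub_cancel_right]
    rw [h1, map_sub, ext_phi, ext_inc, map_mul, rho_inc]
    rfl
  mul_right A B C := by
    conv_lhs => rw [← h.phi_psi A]
    rw [ext_phi, rho_apply_mul]
    conv_rhs => rw [← h.phi_psi A, comul_phi, TensorProduct.map_map]
    have : ∀ B, h.ext.flip B ∘ₗ h.phi = h.rho.toLinearMap.flip B := fun B =>
      LinearMap.ext fun a => by simp [ext_phi]
    rw [this, this]

/-- As `phi` respects coproducts, the left side is the convolution of `phi` with `a ↦ rho a B`. It
follows the recursion of `sigma` because `x ⋆ (C D) = (x ⋆ C) D + C (x ▷ D)`. -/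
theorem star_phi (a : Ub) (B : U) : star h.ext (h.phi a) B = h.sigma a B := by
  have key : ∀ (x : gb) (t : Ub ⊗[ℝ] Ub),
      LinearMap.mul' ℝ U (TensorProduct.map h.phi (h.rho.toLinearMap.flip B)
        ((ι ℝ x ⊗ₜ[ℝ] 1 + 1 ⊗ₜ[ℝ] ι ℝ x) * t)) =
      h.starLin x (LinearMap.mul' ℝ U (TensorProduct.map h.phi (h.rho.toLinearMap.flip B) t)) := by
    intro x t
    induction t with
    | zero => simp
    | add s t hs ht => simp only [mul_add, map_add, hs, ht]
    | tmul a b => simp [add_mul, derLin_mul, starLin_apply, phi_inc_mul, mul_assoc, add_assoc]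
  have h1 : star h.ext (h.phi a) B = LinearMap.mul' ℝ U
      (TensorProduct.map h.phi (h.rho.toLinearMap.flip B) (Coalgebra.comul (R := ℝ) a)) := by
    change LinearMap.mul' ℝ U (TensorProduct.map LinearMap.id (h.ext.flip B)
      (Coalgebra.comul (R := ℝ) (h.phi a))) = _
    rw [comul_phi, TensorProduct.map_map]
    congr 3
    ext a
    simp [ext_phi]
  rw [h1]
  clear h1
  induction a using induction_left with
  | one => simp [Algebra.TensorProduct.one_def]
  | add a b ha hb => simp only [map_add, LinearMap.add_apply, ha, hb]
  | smul r a ha => simp only [map_smul, LinearMap.smul_apply, ha]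
  | mul x a ha => rw [comul_inc_mul, key, ha]; simp

end IsPostLie

/-! ### Uniqueness of the extension -/

/-- The axioms prescribe `x ▷ 1` only for letters. The product rule with `B = C = 1` says that `A ↦
A ▷ 1` is a convolution idempotent, which determines it. -/
theorem IsExtension.apply_one {T : U →ₗ[ℝ] U →ₗ[ℝ] U} (hT : IsExtension tri T) (A : U) :
    T A 1 = Coalgebra.counit (R := ℝ) A • (1 : U) := by
  refine eq_counit_of_conv_idempotent (T.flip 1) ?_ (fun a => ?_) A
  · simp [hT.one_left]
  · have := hT.mul_right a 1 1
    rwa [one_mul] at this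

theorem IsExtension.isDer {T : U →ₗ[ℝ] U →ₗ[ℝ] U} (hT : IsExtension tri T) (x : g) :
    IsDer (T (ι ℝ x)) := fun a b => by
  rw [hT.mul_right, comul_inc]
  simp [hT.one_left]

namespace IsPostLie

variable (h : IsPostLie tri e)
include h

theorem isExtension_inc {T : U →ₗ[ℝ] U →ₗ[ℝ] U} (hT : IsExtension tri T) (x : gb) :
    T (ι ℝ (e x)) = h.derLin x :=
  IsDer.ext (hT.isDer _) (h.derLin_mul x) fun y => by rw [hT.extend, derLin_inc]

/-- The axiom for `x A ▷ y` amounts to `(x ⋆ A) ▷ y = x ▷ (A ▷ y)`. Induction along `⋆`, that is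
along `U(gb)`, therefore avoids the term `(x ▷ A) ▷ y`. -/
theorem isExtension_phi {T : U →ₗ[ℝ] U →ₗ[ℝ] U} (hT : IsExtension tri T) (a : Ub) (y : g) :
    T (h.phi a) (ι ℝ y) = h.rho a (ι ℝ y) := by
  induction a using induction_left with
  | one => simp [hT.one_left]
  | add a b ha hb => simp only [map_add, LinearMap.add_apply, ha, hb]
  | smul r a ha => simp only [map_smul, LinearMap.smul_apply, ha]
  | mul x a ha =>
    rw [phi_inc_mul, map_add, LinearMap.add_apply, hT.gen_mul_left, h.isExtension_inc hT,
      sub_add_cancel, ha, map_mul, rho_inc]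
    rfl

theorem isExtension_unique {T : U →ₗ[ℝ] U →ₗ[ℝ] U} (hT : IsExtension tri T) : T = h.ext := by
  -- The induction runs over the second argument with the first one free, since the product rule
  -- splits the first by the coproduct.
  have hflip : ∀ B, T.flip B = h.ext.flip B := by
    intro B
    induction B using induction_left with
    | one =>
      refine LinearMap.ext fun A => ?_
      rw [LinearMap.flip_apply, LinearMap.flip_apply, hT.apply_one, h.isExtension_ext.apply_one]
    | add a b ha hb => rw [map_add, map_add, ha, hb]
    | smul r a ha => rw [map_smul, map_smul, ha]
    | mul x a ha =>
      have hx : T.flip (ι ℝ x) = h.ext.flip (ι ℝ x) := LinearMap.ext fun A => by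
        rw [← h.phi_psi A, LinearMap.flip_apply, LinearMap.flip_apply, h.isExtension_phi hT,
          h.isExtension_phi h.isExtension_ext]
      refine LinearMap.ext fun A => ?_
      rw [LinearMap.flip_apply, LinearMap.flip_apply, hT.mul_right, h.isExtension_ext.mul_right,
        hx, ha]
  refine LinearMap.ext fun A => LinearMap.ext fun B => ?_
  exact LinearMap.congr_fun (hflip B) A

/-! ### Transport of the Hopf algebra structure along `phi` -/

theorem phi_surjective : Function.Surjective h.phi := fun a => ⟨_, h.phi_psi a⟩

theorem star_phi_phi (a b : Ub) : star h.ext (h.phi a) (h.phi b) = h.phi (a * b) := by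
  rw [star_phi, phi_mul]

/-- The antipode of `(U(g), ⋆, Δ)`. -/
def antipode : U →ₗ[ℝ] U := h.phi ∘ₗ HopfAlgebra.antipode ℝ ∘ₗ h.psi

theorem antipode_phi (a : Ub) : h.antipode (h.phi a) = h.phi (HopfAlgebra.antipode ℝ a) := by
  simp [antipode, psi_phi]

theorem lift_star_map_phi (t : Ub ⊗[ℝ] Ub) :
    TensorProduct.lift (star h.ext) (TensorProduct.map h.phi h.phi t) =
      h.phi (LinearMap.mul' ℝ Ub t) := by
  induction t with
  | zero => simp
  | add s t hs ht => simp only [map_add, hs, ht]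
  | tmul a b => simp [star_phi_phi]

theorem isHopfAlgebraWith : IsHopfAlgebraWith (star h.ext) 1 h.antipode where
  mul_assoc a b c := by
    obtain ⟨a, rfl⟩ := h.phi_surjective a
    obtain ⟨b, rfl⟩ := h.phi_surjective b
    obtain ⟨c, rfl⟩ := h.phi_surjective c
    simp only [star_phi_phi, mul_assoc]
  one_mul a := by
    obtain ⟨a, rfl⟩ := h.phi_surjective a
    rw [← h.phi_one, star_phi_phi, one_mul]
  mul_one a := by
    obtain ⟨a, rfl⟩ := h.phi_surjective a
    rw [← h.phi_one, star_phi_phi, mul_one]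
  comul_mul a b := by
    obtain ⟨a, rfl⟩ := h.phi_surjective a
    obtain ⟨b, rfl⟩ := h.phi_surjective b
    have key : ∀ s t : Ub ⊗[ℝ] Ub, TensorProduct.map h.phi h.phi (s * t) =
        TensorProduct.map₂ (star h.ext) (star h.ext) (TensorProduct.map h.phi h.phi s)
          (TensorProduct.map h.phi h.phi t) := by
      intro s t
      induction s with
      | zero => simp
      | add s s' hs hs' => simp only [add_mul, map_add, LinearMap.add_apply, hs, hs']
      | tmul a b =>
        induction t with
        | zero => simp
        | add t t' ht ht' => simp only [mul_add, map_add, ht, ht']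
        | tmul a' b' => simp [star_phi_phi]
    rw [star_phi_phi, comul_phi, comul_phi, comul_phi,
      Bialgebra.comul_mul, key]
  comul_one := Bialgebra.comul_one
  counit_mul a b := by
    obtain ⟨a, rfl⟩ := h.phi_surjective a
    obtain ⟨b, rfl⟩ := h.phi_surjective b
    rw [star_phi_phi, counit_phi, counit_phi, counit_phi,
      Bialgebra.counit_mul]
  counit_one := Bialgebra.counit_one
  antipode_left a := by
    obtain ⟨a, rfl⟩ := h.phi_surjective a
    have hc : h.antipode ∘ₗ h.phi = h.phi ∘ₗ HopfAlgebra.antipode ℝ :=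
      LinearMap.ext h.antipode_phi
    rw [comul_phi, counit_phi, TensorProduct.map_map, hc, LinearMap.id_comp]
    have := h.lift_star_map_phi ((HopfAlgebra.antipode ℝ).rTensor Ub (Coalgebra.comul (R := ℝ) a))
    rw [HopfAlgebra.mul_antipode_rTensor_comul_apply, LinearMap.rTensor, TensorProduct.map_map,
      LinearMap.comp_id] at this
    rw [this, Algebra.algebraMap_eq_smul_one, map_smul, phi_one]
  antipode_right a := by
    obtain ⟨a, rfl⟩ := h.phi_surjective a
    have hc : h.antipode ∘ₗ h.phi = h.phi ∘ₗ HopfAlgebra.antipode ℝ :=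
      LinearMap.ext h.antipode_phi
    rw [comul_phi, counit_phi, TensorProduct.map_map, hc, LinearMap.id_comp]
    have := h.lift_star_map_phi ((HopfAlgebra.antipode ℝ).lTensor Ub (Coalgebra.comul (R := ℝ) a))
    rw [HopfAlgebra.mul_antipode_lTensor_comul_apply, LinearMap.lTensor, TensorProduct.map_map,
      LinearMap.comp_id] at this
    rw [this, Algebra.algebraMap_eq_smul_one, map_smul, phi_one]

end IsPostLie

end PostLie

/-! ### The post-Lie structure of `L₀` and the normally ordered basis -/

namespace MultiIndices

open MvPolynomial

variable {d : ℕ}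

theorem bilin_ext {B B' : Space d →ₗ[ℝ] Space d →ₗ[ℝ] Space d}
    (h : ∀ a b, B (Finsupp.single a 1) (Finsupp.single b 1) =
      B' (Finsupp.single a 1) (Finsupp.single b 1)) : B = B' :=
  Finsupp.lhom_ext' fun a => LinearMap.ext_ring (Finsupp.lhom_ext' fun b =>
    LinearMap.ext_ring (h a b))

theorem polyD_monomial (n : NN d) (γ : {γ : MIdx d // 0 ≤ wt γ}) :
    polyD n (monomial γ.1 1) = zD (γ, n) := by
  have : (monomial γ.1 (1 : ℝ) : Poly d) = basisMonomials (Var d) ℝ γ.1 := by simp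
  rw [this, polyD, Module.Basis.constr_basis, dif_pos γ.2]

/-- All monomials `z^β` of `p` have `[β] ≥ 0`. -/
def NonnegWt (p : Poly d) : Prop := ∀ β, coeff β p ≠ 0 → 0 ≤ wt β

theorem nonnegWt_monomial (γ : {γ : MIdx d // 0 ≤ wt γ}) : NonnegWt (monomial γ.1 (1 : ℝ)) := by
  intro β hβ
  rw [coeff_monomial] at hβ
  split_ifs at hβ with h
  · exact h ▸ γ.2
  · exact absurd rfl hβ

/-- Carries identities from `z^γ D^{(n)}` to `p D^{(n)}`. The weight condition is essential: `polyD`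
discards monomials of negative weight. -/
theorem map_polyD {M : Type*} [AddCommGroup M] [Module ℝ M] (n : NN d)
    (F : Space d →ₗ[ℝ] M) (G : Poly d →ₗ[ℝ] M)
    (h : ∀ γ : {γ : MIdx d // 0 ≤ wt γ}, F (zD (γ, n)) = G (monomial γ.1 1))
    {p : Poly d} (hp : NonnegWt p) : F (polyD n p) = G p := by
  conv_lhs => rw [p.as_sum]
  conv_rhs => rw [p.as_sum]
  rw [map_sum, map_sum, map_sum]
  refine Finset.sum_congr rfl fun β hβ => ?_
  have h1 := h ⟨β, hp β (mem_support_iff.1 hβ)⟩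
  have : (monomial β (coeff β p) : Poly d) = coeff β p • monomial β 1 := by
    simp [smul_monomial]
  rw [this, map_smul, map_smul, map_smul, ← h1, ← polyD_monomial]

/-- The derivation `z^γ D^{(n)}` raises the weight by `[γ] + 1` and `∂_i` preserves it, so iterated
products never meet the truncation in `polyD`. -/
theorem nonnegWt_toDer (x : Space d) {p : Poly d} (hp : NonnegWt p) : NonnegWt (toDer x p) := by
  have hadd : ∀ {p q : Poly d}, NonnegWt p → NonnegWt q → NonnegWt (p + q) := by
    intro p q hp hq β hβ
    rw [coeff_add] at hβ
    by_cases h : coeff β p = 0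
    · rw [h, zero_add] at hβ; exact hq β hβ
    · exact hp β h
  have hsmul : ∀ (r : ℝ) {p : Poly d}, NonnegWt p → NonnegWt (r • p) := by
    intro r p hp β hβ
    rw [coeff_smul] at hβ
    exact hp β (right_ne_zero_of_mul hβ)
  have hsum : ∀ (s : Finset (MIdx d)) (f : MIdx d → Poly d), (∀ i ∈ s, NonnegWt (f i)) →
      NonnegWt (∑ i ∈ s, f i) := by
    intro s f hf
    induction s using Finset.cons_induction with
    | empty => intro β hβ; simp at hβ
    | cons a s ha ih =>
      rw [Finset.sum_cons]
      exact hadd (hf a (by simp)) (ih fun i hi => hf i (by simp [hi]))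
  rw [p.as_sum, map_sum]
  refine hsum _ _ fun γ hγ => ?_
  have hγ := hp γ (mem_support_iff.1 hγ)
  have : (monomial γ (coeff γ p) : Poly d) = coeff γ p • monomial γ 1 := by
    simp [smul_monomial]
  rw [this, Derivation.map_smul]
  refine hsmul _ ?_
  induction x using Finsupp.induction_linear with
  | zero => intro β hβ; simp at hβ
  | add x y hx hy => rw [map_add, Derivation.add_apply]; exact hadd hx hy
  | single a r =>
    rw [toDer_single, Derivation.smul_apply]
    refine hsmul r ?_
    rcases a with ⟨γ', n⟩ | i
    · exact fun β hβ => good_mul_D γ' ⟨γ, hγ⟩ n β hβ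
    · exact fun β hβ => good_del ⟨γ, hγ⟩ i β hβ

theorem tri_zD (x : Space d) (γ : {γ : MIdx d // 0 ≤ wt γ}) (n : NN d) :
    bilin triGen x (zD (γ, n)) = polyD n (toDer x (monomial γ.1 1)) := by
  induction x using Finsupp.induction_linear with
  | zero => simp
  | add x y hx hy => simp only [map_add, LinearMap.add_apply, Derivation.add_apply, hx, hy]
  | single a r =>
    rw [bilin_single, one_smul, toDer_single, Derivation.smul_apply, map_smul]
    rcases a with ⟨γ', m⟩ | i <;> rfl

theorem tri_dl (x : Space d) (i : Fin (d + 1)) : bilin triGen x (dl i) = 0 := by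
  induction x using Finsupp.induction_linear with
  | zero => simp
  | add x y hx hy => simp only [map_add, LinearMap.add_apply, hx, hy, add_zero]
  | single a r =>
    rw [bilin_single]
    rcases a with ⟨γ', m⟩ | i <;> simp [triGen]

theorem tri_polyD (x : Space d) (n : NN d) {p : Poly d} (hp : NonnegWt p) :
    bilin triGen x (polyD n p) = polyD n (toDer x p) :=
  map_polyD n (bilin triGen x) (polyD n ∘ₗ (toDer x : Poly d →ₗ[ℝ] Poly d))
    (fun γ => tri_zD x γ n) hp

theorem br₀_polyD_zD (n : NN d) (a : TildeIdx d) {p : Poly d} (hp : NonnegWt p) :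
    bilin brGen₀ (polyD n p) (zD a) = 0 :=
  map_polyD n ((bilin brGen₀).flip (zD a)) 0 (fun γ => by simp [brGen₀]) hp

theorem br₀_polyD_dl (n : NN d) (i : Fin (d + 1)) {p : Poly d} (hp : NonnegWt p) :
    bilin brGen₀ (polyD n p) (dl i) = (n i : ℝ) • polyD (n - unitVec i) p :=
  map_polyD n ((bilin brGen₀).flip (dl i)) ((n i : ℝ) • polyD (n - unitVec i))
    (fun γ => by
      rw [LinearMap.flip_apply, bilin_single, LinearMap.smul_apply, polyD_monomial]
      simp [brGen₀]) hp

theorem br_eq (x y : Space d) :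
    bilin brGen x y = bilin brGen₀ x y + bilin triGen x y - bilin triGen y x := by
  have : bilin (d := d) brGen + (bilin triGen).flip = bilin brGen₀ + bilin triGen := by
    refine bilin_ext fun a b => ?_
    simp only [LinearMap.add_apply, LinearMap.flip_apply, bilin_single, one_smul]
    rcases a with ⟨γ, n⟩ | i <;> rcases b with ⟨γ', m⟩ | j <;>
      simp [brGen, brGen₀, triGen, sub_eq_neg_add]
  rw [eq_sub_iff_add_eq]
  exact LinearMap.congr_fun (LinearMap.congr_fun this x) y

/-- On coefficients, `x ▷ ·` is application of the derivation `toDer x`, and `toDer` turns the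
bracket of `L` into the commutator. -/
theorem br_tri (x y z : Space d) : bilin triGen (bilin brGen x y) z =
    bilin triGen x (bilin triGen y z) - bilin triGen y (bilin triGen x z) := by
  induction z using Finsupp.induction_linear with
  | zero => simp
  | add z z' hz hz' => simp only [map_add, hz, hz']; abel
  | single a r =>
    have e : (Finsupp.single a r : Space d) = r • Finsupp.single a 1 := by simp
    rw [e]
    simp only [map_smul, ← smul_sub]
    congr 1
    rcases a with ⟨γ, n⟩ | i
    · have hγ := nonnegWt_monomial γ
      rw [tri_zD, tri_zD, tri_zD, tri_polyD _ _ (nonnegWt_toDer _ hγ),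
        tri_polyD _ _ (nonnegWt_toDer _ hγ), toDer_bracket, Derivation.commutator_apply, map_sub]
    · simp [tri_dl]

/-- `x ▷ ·` acts on the coefficient and fixes `n`, whereas `[·,∂_i]₀` acts on `n` and fixes the
coefficient, so the two commute. On the other pairs of basis elements all terms vanish. -/
theorem tri_br₀ (x y z : Space d) : bilin triGen x (bilin brGen₀ y z) =
    bilin brGen₀ (bilin triGen x y) z + bilin brGen₀ y (bilin triGen x z) := by
  have hC : ∀ (γ : {γ : MIdx d // 0 ≤ wt γ}) (n : NN d) (i : Fin (d + 1)),
      bilin triGen x (bilin brGen₀ (zD (γ, n)) (dl i)) =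
        bilin brGen₀ (bilin triGen x (zD (γ, n))) (dl i) := by
    intro γ n i
    rw [tri_zD, br₀_polyD_dl _ _ (nonnegWt_toDer _ (nonnegWt_monomial γ)), bilin_single, one_smul,
      one_smul]
    simp only [brGen₀]
    rw [map_smul, tri_zD]
  have key : ((bilin brGen₀).compr₂ (bilin triGen x) : Space d →ₗ[ℝ] Space d →ₗ[ℝ] Space d) =
      (bilin brGen₀) ∘ₗ bilin triGen x + (bilin brGen₀).compl₂ (bilin triGen x) := by
    refine bilin_ext fun a b => ?_
    simp only [LinearMap.add_apply, LinearMap.compr₂_apply, LinearMap.comp_apply,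
      LinearMap.compl₂_apply]
    rcases a with ⟨γ, n⟩ | i <;> rcases b with ⟨γ', m⟩ | j
    · rw [tri_zD, tri_zD, br₀_polyD_zD _ _ (nonnegWt_toDer _ (nonnegWt_monomial γ)),
        br₀_skew _ (polyD _ _),
        br₀_polyD_zD _ _ (nonnegWt_toDer _ (nonnegWt_monomial γ'))]
      simp [brGen₀]
    · rw [hC, tri_dl, map_zero, add_zero]
    · rw [tri_dl, br₀_skew (dl i), br₀_skew (dl i), map_neg, hC]
      simp
    · rw [tri_dl, tri_dl]
      simp [brGen₀]
  exact LinearMap.congr_fun (LinearMap.congr_fun key y) z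

variable (d) in
/-- The identification of the vector spaces `L` and `L₀`. -/
def LtoL₀ : L d ≃ₗ[ℝ] L₀ d := (toL d).symm.trans (toL₀ d)

theorem isPostLie : PostLie.IsPostLie (tri₀ d) (LtoL₀ d) where
  tri_lie x y z := tri_br₀ (d := d) x y z
  lie_tri x y z := br_tri (d := d) x y z
  e_lie x y := br_eq (d := d) x y

open UniversalEnvelopingAlgebra UEA

attribute [-simp] UniversalEnvelopingAlgebra.ι_apply

local notation "U₀" => UniversalEnvelopingAlgebra ℝ (L₀ d)

/-! ### A right module over `U(L₀)` -/

/-- The derivations of the polynomials in the basis elements that extend `[·, ∂_i]₀`. -/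
def symDer (i : Fin (d + 1)) : Derivation ℝ (MvPolynomial (Gen d) ℝ) (MvPolynomial (Gen d) ℝ) :=
  mkDerivation ℝ (Sum.elim (fun a => (a.2 i : ℝ) • X (Sum.inl (a.1, a.2 - unitVec i)))
    (fun _ => 0))

@[simp] theorem symDer_inl (i : Fin (d + 1)) (a : TildeIdx d) :
    symDer i (X (Sum.inl a)) = (a.2 i : ℝ) • X (Sum.inl (a.1, a.2 - unitVec i)) := by
  simp [symDer]

@[simp] theorem symDer_inr (i j : Fin (d + 1)) : symDer (d := d) i (X (Sum.inr j)) = 0 := by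
  simp [symDer]

theorem symDer_comm (i j : Fin (d + 1)) : ⁅symDer (d := d) i, symDer j⁆ = 0 := by
  refine derivation_ext fun v => ?_
  rw [Derivation.commutator_apply, Derivation.coe_zero, Pi.zero_apply]
  rcases v with ⟨γ, n⟩ | q
  · simp only [symDer_inl, Derivation.map_smul, smul_smul]
    rcases eq_or_ne i j with rfl | h
    · exact sub_self _
    · have h' : j ≠ i := fun e => h e.symm
      rw [tsub_right_comm]
      simp [h, h', mul_comm]
  · simp

/-- The operators of right multiplication by the basis elements on the normally ordered
polynomials. -/
def symGen : Gen d → Module.End ℝ (MvPolynomial (Gen d) ℝ)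
  | Sum.inl a => LinearMap.mulLeft ℝ (X (Sum.inl a))
  | Sum.inr i => LinearMap.mulLeft ℝ (X (Sum.inr i)) + (symDer i : _ →ₗ[ℝ] _)

/-- The operators of right multiplication by elements of `L₀` on the normally ordered
polynomials. -/
def symLin : L₀ d →ₗ[ℝ] Module.End ℝ (MvPolynomial (Gen d) ℝ) :=
  Finsupp.linearCombination ℝ symGen ∘ₗ (toL₀ d).symm.toLinearMap

theorem symLin_single (a : Gen d) (r : ℝ) :
    symLin (toL₀ d (Finsupp.single a r)) = r • symGen a := by
  simp [symLin]

theorem symGen_lie_aux (a : TildeIdx d) (i : Fin (d + 1)) :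
    (a.2 i : ℝ) • symGen (Sum.inl (a.1, a.2 - unitVec i)) =
      symGen (Sum.inr i) * symGen (Sum.inl a) - symGen (Sum.inl a) * symGen (Sum.inr i) := by
  refine LinearMap.ext fun p => ?_
  simp only [symGen, LinearMap.sub_apply, Module.End.mul_apply, LinearMap.add_apply,
    LinearMap.mulLeft_apply, Derivation.coeFn_coe, Derivation.leibniz, symDer_inl,
    LinearMap.smul_apply, smul_eq_mul, mul_smul_comm]
  simp only [smul_eq_C_mul]
  ring

/-- The order is that of right multiplications. The mixed case is the Leibniz rule; for two `∂`'s,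
the derivations `symDer` commute and kill the variables of the `∂`'s. -/
theorem symGen_lie (a b : Gen d) : symLin (toL₀ d (brGen₀ a b)) =
    symGen b * symGen a - symGen a * symGen b := by
  rcases a with a | i <;> rcases b with b | j
  · simp only [brGen₀, map_zero]
    refine LinearMap.ext fun p => ?_
    simp only [symGen, LinearMap.sub_apply, Module.End.mul_apply, LinearMap.mulLeft_apply,
      LinearMap.zero_apply]
    ring
  · simp only [brGen₀, map_smul, symLin_single, one_smul]
    exact symGen_lie_aux a j
  · simp only [brGen₀, map_smul, map_neg, symLin_single, one_smul]
    rw [symGen_lie_aux b i, neg_sub]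
  · simp only [brGen₀, map_zero]
    refine LinearMap.ext fun p => ?_
    have h := congrArg (fun E : Derivation ℝ _ _ => E p) (symDer_comm i j)
    simp only [Derivation.commutator_apply, Derivation.coe_zero, Pi.zero_apply] at h
    simp only [symGen, LinearMap.sub_apply, Module.End.mul_apply, LinearMap.add_apply,
      LinearMap.mulLeft_apply, Derivation.coeFn_coe, Derivation.leibniz, symDer_inr, map_add,
      LinearMap.zero_apply, smul_eq_mul]
    linear_combination h

theorem symLin_lie (x y : Space d) : symLin (toL₀ d (bilin brGen₀ x y)) =
    symLin (toL₀ d y) * symLin (toL₀ d x) - symLin (toL₀ d x) * symLin (toL₀ d y) := by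
  induction x using Finsupp.induction_linear with
  | zero => simp
  | add x x' hx hx' =>
    simp only [map_add, LinearMap.add_apply, hx, hx', mul_add, add_mul]
    abel
  | single a r =>
    induction y using Finsupp.induction_linear with
    | zero => simp
    | add y y' hy hy' =>
      simp only [map_add, hy, hy', mul_add, add_mul]
      abel
    | single b s =>
      rw [bilin_single, map_smul, map_smul, map_smul, map_smul, symGen_lie, symLin_single,
        symLin_single, smul_mul_smul_comm, smul_mul_smul_comm, smul_smul, mul_comm s r, smul_sub]

/-- The right action of `U(L₀)` on the normally ordered polynomials. -/
def symAct : U₀ →ₐ[ℝ] (Module.End ℝ (MvPolynomial (Gen d) ℝ))ᵐᵒᵖ :=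
  liftLin ((MulOpposite.opLinearEquiv ℝ).toLinearMap ∘ₗ symLin) (fun x y => by
    simp only [LinearMap.comp_apply, LinearEquiv.coe_coe, MulOpposite.coe_opLinearEquiv,
      ← MulOpposite.op_mul, ← MulOpposite.op_sub]
    exact congrArg _ (symLin_lie (d := d) x y))

/-- The normally ordered polynomial of an element of `U(L₀)`. -/
def symbol : U₀ →ₗ[ℝ] MvPolynomial (Gen d) ℝ :=
  LinearMap.applyₗ (1 : MvPolynomial (Gen d) ℝ) ∘ₗ
    (MulOpposite.opLinearEquiv ℝ).symm.toLinearMap ∘ₗ symAct.toLinearMap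

@[simp] theorem symbol_one : symbol (1 : U₀) = 1 := by simp [symbol]

theorem symbol_mul_inc (u : U₀) (x : L₀ d) : symbol (u * ι ℝ x) = symLin x (symbol u) := by
  simp [symbol, symAct]

theorem symbol_mul_zD (u : U₀) (a : TildeIdx d) :
    symbol (u * ι ℝ (toL₀ d (zD a))) = X (Sum.inl a) * symbol u := by
  rw [symbol_mul_inc, symLin_single, one_smul]; rfl

theorem symbol_mul_dl (u : U₀) (i : Fin (d + 1)) :
    symbol (u * ι ℝ (toL₀ d (dl i))) = X (Sum.inr i) * symbol u + symDer i (symbol u) := by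
  rw [symbol_mul_inc, symLin_single, one_smul]; rfl

theorem symbol_mul_list (u : U₀) (l : List (TildeIdx d)) :
    symbol (u * (l.map fun a => ι ℝ (toL₀ d (zD a))).prod) =
      symbol u * (l.map fun a => X (Sum.inl a)).prod := by
  induction l generalizing u with
  | nil => simp
  | cons a l ih =>
    rw [List.map_cons, List.map_cons, List.prod_cons, List.prod_cons, ← mul_assoc, ih,
      symbol_mul_zD]
    ring

/-- The hypothesis holds when the symbol contains only variables of the `∂`'s; then nothing has to
be commuted past, and right multiplication by `∂_j` has no correction term. -/
theorem symbol_mul_pow (u : U₀) (hu : ∀ i, symDer i (symbol u) = 0) (j : Fin (d + 1)) (k : ℕ) :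
    symbol (u * ι ℝ (toL₀ d (dl j)) ^ k) = symbol u * X (Sum.inr j) ^ k := by
  induction k with
  | zero => simp
  | succ k ih =>
    rw [pow_succ, ← mul_assoc, symbol_mul_dl, ih, Derivation.leibniz, Derivation.leibniz_pow, hu,
      symDer_inr]
    simp
    ring

theorem symbol_mul_pow_list (u : U₀) (hu : ∀ i, symDer i (symbol u) = 0) (m : Fin (d + 1) → ℕ)
    (l : List (Fin (d + 1))) :
    symbol (u * (l.map fun i => ι ℝ (toL₀ d (dl i)) ^ m i).prod) =
      symbol u * (l.map fun i => X (Sum.inr i) ^ m i).prod := by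
  induction l generalizing u with
  | nil => simp
  | cons j l ih =>
    rw [List.map_cons, List.map_cons, List.prod_cons, List.prod_cons, ← mul_assoc, ih,
      symbol_mul_pow u hu, mul_assoc]
    intro i
    rw [symbol_mul_pow u hu, Derivation.leibniz, Derivation.leibniz_pow, hu, symDer_inr]
    simp

/-! ### The normally ordered basis of `U(L₀)` -/

theorem commute_zD (a b : TildeIdx d) :
    Commute (ι ℝ (toL₀ d (zD a))) (ι ℝ (toL₀ d (zD b))) := by
  have h : ⁅toL₀ d (zD a), toL₀ d (zD b)⁆ = 0 := by
    change toL₀ d (bilin brGen₀ (zD a) (zD b)) = 0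
    simp [brGen₀]
  have := inc_lie (R := ℝ) (toL₀ d (zD a)) (toL₀ d (zD b))
  rw [h, map_zero] at this
  exact (sub_eq_zero.1 this.symm)

theorem commute_dl (i j : Fin (d + 1)) :
    Commute (ι ℝ (toL₀ d (dl i))) (ι ℝ (toL₀ d (dl j))) := by
  have h : ⁅toL₀ d (dl i), toL₀ d (dl j)⁆ = 0 := by
    change toL₀ d (bilin brGen₀ (dl i) (dl j)) = 0
    simp [brGen₀]
  have := inc_lie (R := ℝ) (toL₀ d (dl i)) (toL₀ d (dl j))
  rw [h, map_zero] at this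
  exact (sub_eq_zero.1 this.symm)

theorem zD_mul_dl (a : TildeIdx d) (i : Fin (d + 1)) :
    ι ℝ (toL₀ d (zD a)) * ι ℝ (toL₀ d (dl i)) = ι ℝ (toL₀ d (dl i)) * ι ℝ (toL₀ d (zD a)) +
      (a.2 i : ℝ) • ι ℝ (toL₀ d (zD (a.1, a.2 - unitVec i))) := by
  have h : ⁅toL₀ d (zD a), toL₀ d (dl i)⁆ = (a.2 i : ℝ) • toL₀ d (zD (a.1, a.2 - unitVec i)) := by
    change toL₀ d (bilin brGen₀ (zD a) (dl i)) = _
    rw [bilin_single, one_smul, one_smul, ← map_smul]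
    rfl
  have := inc_lie (R := ℝ) (toL₀ d (zD a)) (toL₀ d (dl i))
  rw [h, map_smul] at this
  rw [this]
  abel

/-- The product `∂_0^{m_0} ⋯ ∂_d^{m_d}` in `U(L₀)`. -/
def dlProd (m : Fin (d + 1) → ℕ) : U₀ := (List.ofFn fun i => ι ℝ (toL₀ d (dl i)) ^ m i).prod

/-- The normally ordered monomials in `U(L₀)`. -/
def normalMonomial (J : Multiset (TildeIdx d) × (Fin (d + 1) → ℕ)) : U₀ :=
  dlProd J.2 * (J.1.toList.map fun a => ι ℝ (toL₀ d (zD a))).prod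

/-- `toList` chooses an arbitrary enumeration; the choice is immaterial since the `z^γ D^{(n)}`
commute in `U(L₀)`. This is the symmetry of the basis. -/
theorem normalMonomial_coe (l : List (TildeIdx d)) (m : Fin (d + 1) → ℕ) :
    normalMonomial (Multiset.ofList l, m) =
      dlProd m * (l.map fun a => ι ℝ (toL₀ d (zD a))).prod := by
  have h : (Multiset.ofList l).toList.Perm l := Multiset.coe_eq_coe.1 (Multiset.coe_toList _)
  rw [normalMonomial]
  congr 1
  refine (h.map _).prod_eq' ?_
  rw [List.pairwise_map]
  exact List.pairwise_of_forall fun a b => commute_zD a b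

theorem normalMonomial_cons (a : TildeIdx d) (s : Multiset (TildeIdx d)) (m : Fin (d + 1) → ℕ) :
    normalMonomial (a ::ₘ s, m) = normalMonomial (s, m) * ι ℝ (toL₀ d (zD a)) := by
  induction s using Quotient.inductionOn with
  | h l =>
    have h : a ::ₘ (Multiset.ofList l) = Multiset.ofList (l ++ [a]) := by
      rw [Multiset.cons_coe, Multiset.coe_eq_coe]
      exact (List.perm_append_singleton a l).symm
    change normalMonomial (a ::ₘ (Multiset.ofList l), m) = normalMonomial (Multiset.ofList l, m) * _
    rw [h, normalMonomial_coe, normalMonomial_coe, List.map_append, List.prod_append, mul_assoc]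
    simp

theorem dlProd_mul_dl (m : Fin (d + 1) → ℕ) (i : Fin (d + 1)) :
    dlProd m * ι ℝ (toL₀ d (dl i)) = dlProd (m + Pi.single i 1) := by
  -- Absence of repetitions ensures that exactly one exponent is raised.
  have key : ∀ l : List (Fin (d + 1)), l.Nodup → i ∈ l →
      (l.map fun j => ι ℝ (toL₀ d (dl j)) ^ m j).prod * ι ℝ (toL₀ d (dl i)) =
        (l.map fun j => ι ℝ (toL₀ d (dl j)) ^ (m j + if j = i then 1 else 0)).prod := by
    intro l hl hi
    induction l with
    | nil => simp at hi
    | cons j l ih =>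
      rw [List.nodup_cons] at hl
      rw [List.map_cons, List.map_cons, List.prod_cons, List.prod_cons]
      by_cases hj : j = i
      · subst hj
        have h1 : (l.map fun k => ι ℝ (toL₀ d (dl k)) ^ (m k + if k = j then 1 else 0)) =
            l.map fun k => ι ℝ (toL₀ d (dl k)) ^ m k := by
          refine List.map_congr_left fun k hk => ?_
          have hk : k ≠ j := fun h => hl.1 (h ▸ hk)
          simp [hk]
        have h2 : Commute ((l.map fun k => ι ℝ (toL₀ d (dl k)) ^ m k).prod)
            (ι ℝ (toL₀ d (dl j))) := by
          refine Commute.list_prod_left _ _ fun x hx => ?_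
          obtain ⟨k, _, rfl⟩ := List.mem_map.1 hx
          exact (commute_dl k j).pow_left _
        rw [h1, mul_assoc, h2.eq, ← mul_assoc]
        simp [pow_succ]
      · have hi' : i ∈ l := (List.mem_cons.1 hi).resolve_left fun h => hj h.symm
        rw [mul_assoc, ih hl.2 hi']
        simp [hj]
  rw [dlProd, dlProd, List.ofFn_eq_map, List.ofFn_eq_map]
  rw [key _ (List.nodup_finRange _) (List.mem_finRange i)]
  simp [Pi.single_apply]

theorem normalMonomial_zero (m : Fin (d + 1) → ℕ) : normalMonomial (0, m) = dlProd m := by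
  simp [normalMonomial]

theorem span_normalMonomial : Submodule.span ℝ (Set.range (normalMonomial (d := d))) = ⊤ := by
  set S := Submodule.span ℝ (Set.range (normalMonomial (d := d)))
  have hz : ∀ a, ∀ u ∈ S, u * ι ℝ (toL₀ d (zD a)) ∈ S := by
    intro a u hu
    induction hu using Submodule.span_induction with
    | mem u hu =>
      obtain ⟨⟨s, m⟩, rfl⟩ := hu
      rw [← normalMonomial_cons]
      exact Submodule.subset_span ⟨_, rfl⟩
    | zero => simp
    | add u v _ _ hu hv => rw [add_mul]; exact add_mem hu hv
    | smul r u _ hu => rw [smul_mul_assoc]; exact Submodule.smul_mem _ r hu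
  -- Moving `∂_i` left past `z^γ D^{(n)}` leaves a multiple of `z^γ D^{(n - e_i)}` in its place,
  -- which `hz` absorbs.
  have hm : ∀ i s m, normalMonomial (s, m) * ι ℝ (toL₀ d (dl i)) ∈ S := by
    intro i s m
    induction s using Multiset.induction with
    | empty =>
      rw [normalMonomial_zero, dlProd_mul_dl, ← normalMonomial_zero]
      exact Submodule.subset_span ⟨_, rfl⟩
    | cons a s ih =>
      rw [normalMonomial_cons, mul_assoc, zD_mul_dl, mul_add, ← mul_assoc, mul_smul_comm]
      exact add_mem (hz a _ ih) (Submodule.smul_mem _ _ (hz _ _ (Submodule.subset_span ⟨_, rfl⟩)))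
  have hd : ∀ i, ∀ u ∈ S, u * ι ℝ (toL₀ d (dl i)) ∈ S := by
    intro i u hu
    induction hu using Submodule.span_induction with
    | mem u hu => obtain ⟨⟨s, m⟩, rfl⟩ := hu; exact hm i s m
    | zero => simp
    | add u v _ _ hu hv => rw [add_mul]; exact add_mem hu hv
    | smul r u _ hu => rw [smul_mul_assoc]; exact Submodule.smul_mem _ r hu
  have hx : ∀ (x : Space d), ∀ u ∈ S, u * ι ℝ (toL₀ d x) ∈ S := by
    intro x u hu
    induction x using Finsupp.induction_linear with
    | zero => simp
    | add x y hx hy => rw [map_add, map_add, mul_add]; exact add_mem hx hy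
    | single a r =>
      have e : (Finsupp.single a r : Space d) = r • Finsupp.single a 1 := by simp
      rw [e, map_smul, map_smul, mul_smul_comm]
      refine Submodule.smul_mem _ r ?_
      rcases a with a | i
      · exact hz a u hu
      · exact hd i u hu
  rw [eq_top_iff]
  intro u _
  induction u using induction_right with
  | one => exact Submodule.subset_span ⟨(0, 0), by simp [normalMonomial_zero, dlProd]⟩
  | add u v hu hv => exact add_mem (hu trivial) (hv trivial)
  | smul r u hu => exact Submodule.smul_mem _ r (hu trivial)
  | mul u x hu => exact hx ((toL₀ d).symm x) u (hu trivial)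

/-- Exponents of the normally ordered monomials. -/
def expEquiv : Multiset (TildeIdx d) × (Fin (d + 1) → ℕ) ≃ (Gen d →₀ ℕ) :=
  (Equiv.prodCongr (by classical exact Multiset.toFinsupp.toEquiv)
    Finsupp.equivFunOnFinite.symm).trans Finsupp.sumFinsuppEquivProdFinsupp.symm

theorem monomial_expEquiv (s : Multiset (TildeIdx d)) (m : Fin (d + 1) → ℕ) :
    (monomial (expEquiv (s, m)) (1 : ℝ) : MvPolynomial (Gen d) ℝ) =
      (∏ i, X (Sum.inr i) ^ m i) * (s.map fun a => X (Sum.inl a)).prod := by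
  classical
  induction s using Multiset.induction with
  | empty =>
    have h : expEquiv ((0 : Multiset (TildeIdx d)), m) =
        ∑ i, Finsupp.single (Sum.inr i) (m i) := by
      ext v
      rcases v with a | i <;>
        simp [expEquiv, Finsupp.finsetSum_apply, Finsupp.single_apply]
    rw [h, Multiset.map_zero, Multiset.prod_zero, mul_one, monomial_sum_one]
    simp [X_pow_eq_monomial]
  | cons a s ih =>
    have h : expEquiv (a ::ₘ s, m) = Finsupp.single (Sum.inl a) 1 + expEquiv (s, m) := by
      ext v
      rcases v with b | i
      · simp [expEquiv, Finsupp.single_apply, Multiset.count_cons, eq_comm, add_comm]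
      · simp [expEquiv]
    rw [h, ← one_mul (1 : ℝ), ← monomial_mul, ih, Multiset.map_cons, Multiset.prod_cons]
    change X (Sum.inl a) * _ = _
    ring

/-- Normal order is what makes all correction terms vanish: the `∂`'s are multiplied first, when no
variable of a `z^γ D^{(n)}` is present. Distinct monomials as values give linear independence, in
place of a Poincaré–Birkhoff–Witt argument. -/
theorem symbol_normalMonomial (J : Multiset (TildeIdx d) × (Fin (d + 1) → ℕ)) :
    symbol (normalMonomial J) = monomial (expEquiv J) 1 := by
  obtain ⟨s, m⟩ := J
  rw [monomial_expEquiv, normalMonomial, symbol_mul_list, dlProd, List.ofFn_eq_map]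
  have := symbol_mul_pow_list (d := d) 1 (by simp) m (List.finRange _)
  rw [one_mul] at this
  rw [this, symbol_one, one_mul, ← List.ofFn_eq_map, List.prod_ofFn]
  congr 1
  conv_rhs => rw [← Multiset.coe_toList s]
  simp

theorem linearIndependent_normalMonomial : LinearIndependent ℝ (normalMonomial (d := d)) := by
  refine LinearIndependent.of_comp symbol ?_
  have : ⇑(symbol (d := d)) ∘ normalMonomial = ⇑(basisMonomials (Gen d) ℝ) ∘ expEquiv := by
    funext J
    simp [symbol_normalMonomial]
  rw [this]
  exact (basisMonomials (Gen d) ℝ).linearIndependent.comp _ expEquiv.injective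

/-- The normally ordered basis of `U(L₀)`. -/
def normalBasis : Module.Basis (Multiset (TildeIdx d) × (Fin (d + 1) → ℕ)) ℝ U₀ :=
  Module.Basis.mk linearIndependent_normalMonomial span_normalMonomial.ge

theorem normalBasis_apply (J : Multiset (TildeIdx d) × (Fin (d + 1) → ℕ)) :
    normalBasis J = normalMonomial J := by
  simp [normalBasis]

/-! ### Products of the `∂_i` -/

/-- Since `x ▷ ∂_j = 0`, every derivation `x ▷ ·` kills products of `∂`'s, so on these `⋆` reduces
to concatenation. -/
theorem derLin_dl_pow_mul (u : UniversalEnvelopingAlgebra ℝ (L₀ d)) (x : L d)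
    (hu : isPostLie.derLin x u = 0) (j : Fin (d + 1)) (k : ℕ) :
    isPostLie.derLin x (ι ℝ (toL₀ d (dl j)) ^ k * u) = 0 := by
  induction k with
  | zero => simpa using hu
  | succ k ih =>
    have h : tri₀ d (LtoL₀ d x) (toL₀ d (dl j)) = 0 := tri_dl (d := d) x j
    rw [pow_succ', mul_assoc, isPostLie.derLin_mul, ih, isPostLie.derLin_inc, h, map_zero, zero_mul,
      mul_zero, add_zero]

theorem phi_dl_pow_mul (A : UniversalEnvelopingAlgebra ℝ (L d))
    (hA : ∀ x, isPostLie.derLin x (isPostLie.phi A) = 0) (j : Fin (d + 1)) (k : ℕ) :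
    isPostLie.phi (ι ℝ (toL d (dl j)) ^ k * A) = ι ℝ (toL₀ d (dl j)) ^ k * isPostLie.phi A := by
  induction k with
  | zero => simp
  | succ k ih =>
    rw [pow_succ', mul_assoc, isPostLie.phi_inc_mul, ih, derLin_dl_pow_mul _ _ (hA _), add_zero,
      pow_succ', mul_assoc]
    rfl

/-- On products of the `∂_i`, the products of `U(L)` and of `U(L₀)` agree. -/
theorem phi_dlProd (m : Fin (d + 1) → ℕ) :
    isPostLie.phi (List.ofFn fun i => ι ℝ (toL d (dl i)) ^ m i).prod = dlProd m := by
  -- The vanishing under all derivations is carried along because the next application of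
  -- `phi_dl_pow_mul` requires it.
  have key : ∀ l : List (Fin (d + 1)),
      isPostLie.phi (l.map fun i => ι ℝ (toL d (dl i)) ^ m i).prod =
        (l.map fun i => ι ℝ (toL₀ d (dl i)) ^ m i).prod ∧
      ∀ x, isPostLie.derLin x (isPostLie.phi (l.map fun i => ι ℝ (toL d (dl i)) ^ m i).prod) =
        0 := by
    intro l
    induction l with
    | nil => simp
    | cons j l ih =>
      rw [List.map_cons, List.map_cons, List.prod_cons, List.prod_cons, phi_dl_pow_mul _ ih.2]
      exact ⟨by rw [ih.1], fun x => derLin_dl_pow_mul _ x (ih.2 x) j _⟩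
  rw [dlProd, List.ofFn_eq_map, List.ofFn_eq_map]
  exact (key _).1

end MultiIndices

end

/-! ### The theorem for `L` and `L₀` -/

open UniversalEnvelopingAlgebra PostLie MultiIndices in
theorem mainTheorem3 (d : ℕ) :
    -- the extension `T` of the post-Lie product of `L₀` to `U(L₀)` exists and is unique
    ∃ T : UniversalEnvelopingAlgebra ℝ (L₀ d) →ₗ[ℝ]
        UniversalEnvelopingAlgebra ℝ (L₀ d) →ₗ[ℝ] UniversalEnvelopingAlgebra ℝ (L₀ d),
      IsExtension (tri₀ d) T ∧ (∀ T', IsExtension (tri₀ d) T' → T' = T) ∧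
    -- `(U(L₀), ⋆, Δ)` is a Hopf algebra
    ∃ S : UniversalEnvelopingAlgebra ℝ (L₀ d) →ₗ[ℝ] UniversalEnvelopingAlgebra ℝ (L₀ d),
      IsHopfAlgebraWith (star T) 1 S ∧
    -- `Φ` is an isomorphism of Hopf algebras from `U(L)` to `(U(L₀), ⋆, Δ)`
    ∃ Φ : UniversalEnvelopingAlgebra ℝ (L d) ≃ₗc[ℝ] UniversalEnvelopingAlgebra ℝ (L₀ d),
      (∀ x : Space d, Φ (ι ℝ (toL d x)) = ι ℝ (toL₀ d x)) ∧
      Φ 1 = 1 ∧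
      (∀ A B, Φ (A * B) = star T (Φ A) (Φ B)) ∧
      (∀ A, Φ (HopfAlgebra.antipode ℝ A) = S (Φ A)) ∧
    -- the partially symmetric basis `b` of `U(L)`
    ∃ b : Module.Basis (Multiset (TildeIdx d) × (Fin (d + 1) → ℕ)) ℝ
        (UniversalEnvelopingAlgebra ℝ (L d)),
      (∀ (l : List (TildeIdx d)) (m : Fin (d + 1) → ℕ),
        Φ (b (Multiset.ofList l, m)) =
          (List.ofFn fun i => ι ℝ (toL₀ d (dl i)) ^ m i).prod *
            (l.map fun a => ι ℝ (toL₀ d (zD a))).prod) ∧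
    -- the same basis, described inside `U(L)`
      (∀ m : Fin (d + 1) → ℕ,
        b (0, m) = (List.ofFn fun i => ι ℝ (toL d (dl i)) ^ m i).prod) ∧
      ∃ W : Space d →ₗ[ℝ] UniversalEnvelopingAlgebra ℝ (L d) →ₗ[ℝ]
          UniversalEnvelopingAlgebra ℝ (L d),
        (∀ x, W x 1 = ι ℝ (toL d x)) ∧
        (∀ x y A, W x (ι ℝ (toL d y) * A) =
          ι ℝ (toL d y) * W x A - W (bilin triGen y x) A) ∧
        (∀ a s m, b (a ::ₘ s, m) = W (zD a) (b (s, m))) := by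
  have h : IsPostLie (tri₀ d) (LtoL₀ d) := isPostLie
  -- The basis `b` is the preimage of the normally ordered basis under `Φ`, so each assertion about
  -- it is checked after applying `Φ`.
  have hb : ∀ J, h.phiEquiv ((normalBasis.map h.phiEquiv.toLinearEquiv.symm) J) =
      normalMonomial J := fun J => by
    rw [Module.Basis.map_apply, normalBasis_apply]
    exact h.phiEquiv.toLinearEquiv.apply_symm_apply _
  refine ⟨h.ext, h.isExtension_ext, fun T' hT' => h.isExtension_unique hT', h.antipode,
    h.isHopfAlgebraWith, h.phiEquiv, fun x => h.phi_inc _, h.phi_one,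
    fun A B => (h.star_phi_phi A B).symm, fun A => (h.antipode_phi A).symm,
    normalBasis.map h.phiEquiv.toLinearEquiv.symm, fun l m => ?_, fun m => ?_,
    h.right ∘ₗ (toL₀ d).toLinearMap, fun x => h.right_one _, fun x y A => h.right_inc_mul _ _ A,
    fun a s m => ?_⟩
  · rw [hb]
    exact normalMonomial_coe l m
  · refine h.phiEquiv.injective ((hb _).trans ?_)
    rw [normalMonomial_zero]
    exact (phi_dlProd m).symm
  · refine h.phiEquiv.injective ((hb _).trans ?_)
    rw [normalMonomial_cons, ← hb]
    -- Adding a pair to `J` is right multiplication in `U(L₀)`, which is the image of `W` under `Φ`.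
    exact (h.phi_right _ _).symm
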